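/- Let $\sigma=(\sigma_1,\sigma_2,\sigma_3)$ be the Pauli matrices and let $V:\mathbb R^3\to\mathbb R$ be a (Lebesgue measurable) function with $V\le 0$ and $\sup_{x\ne 0}|x|\,|V(x)|<1$. Put $\Gamma:=\sup_{\mathbb R^3} V$. Then there is a constant $c\in(-1,1)$ with $\Gamma<1+c$ and $$\int_{\mathbb R^3}\Big(\frac{|\sigma\cdot\nabla\varphi|^2}{1+c-V}+(1-c+V)|\varphi|^2\Big)\,dx\ \ge\ 0\qquad\text{for all }\varphi\in C_c^\infty(\mathbb R^3,\mathbb C^2). \tag{1}$$ Moreover, for every $c\in(-1,1)$ with $\Gamma<1+c$ satisfying (1) and every $\gamma\in(\Gamma,1+c)$ the following holds. Let $$b_\gamma(\varphi,\varphi)=\int_{\mathbb R^3}\Big(\frac{|\sigma\cdot\nabla\varphi|^2}{\gamma-V}+(2-\gamma+V)|\varphi|^2\Big)\,dx ,\qquad \varphi\in C_c^\infty(\mathbb R^3,\mathbb C^2),$$ and let $\mathcal H_{+1}\subset L^2(\mathbb R^3,\mathbb C^2)$ be the domain of the closure of $b_\gamma$. Let $\mathcal D$ be the set of all pairs $(\varphi,\chi)$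 with $\varphi\in\mathcal H_{+1}$, $\chi\in L^2(\mathbb R^3,\mathbb C^2)$ such that $$(2-\gamma+V)\varphi-i\sigma\cdot\nabla\chi\quad\text{and}\quad -i\sigma\cdot\nabla\varphi+(V-\gamma)\chi$$ belong to $L^2(\mathbb R^3,\mathbb C^2)$ in the weak sense, i.e. the functionals $\eta\mapsto(\eta,(2-\gamma+V)\varphi)+(-i\sigma\cdot\nabla\eta,\chi)$ and $\eta\mapsto(\eta,(V-\gamma)\chi)+(-i\sigma\cdot\nabla\eta,\varphi)$ on $C_c^\infty(\mathbb R^3,\mathbb C^2)$ are represented by elements of $L^2(\mathbb R^3,\mathbb C^2)$. Then $\mathcal D\subset D(r^{-1/2})$, that is, for every $(\varphi,\chi)\in\mathcal D$, $$\int_{\mathbb R^3}\frac{|\varphi(x)|^2}{|x|}\,dx<\infty\qquad\text{and}\qquad\int_{\mathbb R^3}\frac{|\chi(x)|^2}{|x|}\,dx<\infty .$$ -/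

import Mathlib

open MeasureTheory Filter Topology
open scoped ContDiff

namespace DiracHardy

noncomputable section

/-- Physical space `ℝ³` with its Euclidean norm. -/
abbrev Space : Type := EuclideanSpace ℝ (Fin 3)

/-- Two-component spinors `ℂ²` with the Hermitian norm. -/
abbrev Spinor : Type := EuclideanSpace ℂ (Fin 2)

/-- The Hilbert space `L²(ℝ³, ℂ²)`. -/
abbrev L2Spinor : Type := Lp Spinor 2 (volume : Measure Space)

/-- The Pauli matrices `σ₁, σ₂, σ₃`. -/
def pauli : Fin 3 → Matrix (Fin 2) (Fin 2) ℂ :=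
  ![!![0, 1; 1, 0], !![0, -Complex.I; Complex.I, 0], !![1, 0; 0, -1]]

/-- `(σ·∇φ)(x) = ∑ₖ σₖ ∂ₖφ(x)` for a differentiable spinor field `φ`. -/
def sigmaGrad (φ : Space → Spinor) (x : Space) : Spinor :=
  ∑ k : Fin 3, Matrix.toEuclideanLin (pauli k) (fderiv ℝ φ x (EuclideanSpace.single k 1))

/-- `φ ∈ C_c^∞(ℝ³, ℂ²)`. -/
def IsTestSpinor (φ : Space → Spinor) : Prop :=
  ContDiff ℝ ∞ φ ∧ HasCompactSupport φ

/-- The integrand `|σ·∇φ|² / (1 + c - V) + (1 - c + V) |φ|²` of the Hardy-Dirac inequality. -/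
def hardyDiracIntegrand (V : Space → ℝ) (c : ℝ) (φ : Space → Spinor) (x : Space) : ℝ :=
  ‖sigmaGrad φ x‖ ^ 2 / (1 + c - V x) + (1 - c + V x) * ‖φ x‖ ^ 2

/-- The standing assumption on the potential `V`, with the constant `c = c(V) ∈ (-1, 1)`:
`sup V < 1 + c`, and the Hardy-Dirac inequality with constant `c` holds on `C_c^∞(ℝ³, ℂ²)`. -/
structure HardyDiracAssumption (V : Space → ℝ) (c : ℝ) : Prop where
  neg_one_lt : -1 < c
  lt_one : c < 1
  bddAbove : BddAbove (Set.range V)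
  sup_lt : (⨆ x, V x) < 1 + c
  integrable : ∀ φ : Space → Spinor, IsTestSpinor φ → Integrable (hardyDiracIntegrand V c φ)
  nonneg : ∀ φ : Space → Spinor, IsTestSpinor φ → 0 ≤ ∫ x, hardyDiracIntegrand V c φ x

/-- The quadratic form
`b_γ(φ, φ) = ∫ (|σ·∇φ|² / (γ - V) + (2 - γ + V) |φ|²) dx` on `C_c^∞(ℝ³, ℂ²)`. -/
def bForm (V : Space → ℝ) (γ : ℝ) (φ : Space → Spinor) : ℝ :=
  ∫ x, (‖sigmaGrad φ x‖ ^ 2 / (γ - V x) + (2 - γ + V x) * ‖φ x‖ ^ 2)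

/-- The domain of the closure of the form `b_γ`: the `φ ∈ L²` that are `L²`-limits of a
sequence of test spinors which is Cauchy with respect to `b_γ`. -/
def formDomain (V : Space → ℝ) (γ : ℝ) : Set L2Spinor :=
  {φ | ∃ u : ℕ → Space → Spinor, (∀ n, IsTestSpinor (u n)) ∧
    Tendsto (fun n => eLpNorm (fun x => u n x - φ x) 2 volume) atTop (𝓝 0) ∧
    Tendsto (fun p : ℕ × ℕ => bForm V γ (u p.1 - u p.2)) atTop (𝓝 0)}

/-- `W φ - i σ·∇χ ∈ L²(ℝ³, ℂ²)` in the weak sense, for a real multiplier `W`: the functional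
`η ↦ (η, W φ) + (-i σ·∇η, χ)` on test spinors is given by an element of `L²`. -/
def WeakMemL2 (W : Space → ℝ) (φ χ : L2Spinor) : Prop :=
  ∃ F : L2Spinor, ∀ η : Space → Spinor, IsTestSpinor η →
    (∫ x, inner ℂ (η x) ((W x : ℂ) • φ x)) + (∫ x, inner ℂ (-Complex.I • sigmaGrad η x) (χ x)) =
      ∫ x, inner ℂ (η x) (F x)

/-- The domain `𝒟` of the Dirac operator `H₀ + V` (computed with the parameter `γ`), as a set of
pairs `(φ, χ)`, where `L²(ℝ³, ℂ⁴)` is identified with `L²(ℝ³, ℂ²) × L²(ℝ³, ℂ²)`. -/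
def diracDomain (V : Space → ℝ) (γ : ℝ) : Set (L2Spinor × L2Spinor) :=
  {ψ | ψ.1 ∈ formDomain V γ ∧
    WeakMemL2 (fun x => 2 - γ + V x) ψ.1 ψ.2 ∧
    WeakMemL2 (fun x => V x - γ) ψ.2 ψ.1}

/-- The domain `D(r^{-1/2})` in `L²(ℝ³, ℂ⁴)` of multiplication by `|x|^{-1/2}`. -/
def invSqrtDomain : Set (L2Spinor × L2Spinor) :=
  {ψ | MemLp (fun x : Space => ‖x‖ ^ (-(1 / 2) : ℝ) • ψ.1 x) 2 volume ∧
    MemLp (fun x : Space => ‖x‖ ^ (-(1 / 2) : ℝ) • ψ.2 x) 2 volume}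

end

end DiracHardy

/-! Everything rests on a Hardy inequality for the Dirac operator (`hardy_dirac`): for α > 0, the
integral of (1/|x| - α)|φ|² is at most that of |x|/(1 + α|x|) |σ·∇φ|². To prove it, expand |σ·∇φ|²
into Σ|∂ₖφ|² and cross terms. Against a radial weight, the cross terms integrate by parts to
spin-orbit terms (`integral_cross_term`). Each component of total angular momentum has half-integer
spectrum, hence square at least 1/4, so the spin-orbit terms are controlled by the angular
derivatives (`integral_angularMomentum_nonneg`). What survives is the radial derivative, and
completing a square finishes (`hardy_pointwise`, `integral_radial_term`).

If |V| ≤ ν/|x| with ν < 1, then 1/(γ - V) dominates ν⁻¹ times such a Hardy weight, while V costs at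
most ν/|x|. The form therefore controls (ν⁻¹ - ν)∫|φ|²/|x| up to a multiple of ‖φ‖²
(`dirac_form_lower_bound`). This gives an admissible c and, by Fatou along an approximating
sequence, |x|^{-1/2}φ ∈ L² on the form domain.

For χ, the first weak equation reads -iσ·∇χ = F - (2 - γ + V)φ with F ∈ L². Since |Vφ| ≤ ν|x|⁻¹|φ|
and |x|^{-1/2}φ ∈ L², the right side is square integrable against 1/(1 + |x|⁻¹), which is the Hardy
weight for α = 1 away from the origin. The Hardy inequality thus bounds ∫|χ|²/|x| near the origin,
once χ has been cut off and mollified; this needs mollifiers to be uniformly bounded on the weighted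
space (`exists_bump_convolution_inv_norm_le`). -/

namespace DiracHardy

/-! ### Wirtinger inequalities on a double period -/

/-- **Wirtinger's inequality** for antiperiodic functions. -/
theorem wirtinger_antiperiodic {f f' : ℝ → ℂ} (hf : ∀ t, HasDerivAt f (f' t) t)
    (hf' : Continuous f') (hanti : ∀ t, f (t + 2 * Real.pi) = -f t) :
    (1 / 4) * ∫ t in (0 : ℝ)..(4 * Real.pi), ‖f t‖ ^ 2 ≤
      ∫ t in (0 : ℝ)..(4 * Real.pi), ‖f' t‖ ^ 2 := by
  have hpi := Real.pi_pos
  have hab : (0 : ℝ) < 4 * Real.pi := by positivity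
  have hfc : Continuous f := continuous_iff_continuousAt.2 fun t => (hf t).continuousAt
  have hmem : ∀ g : ℝ → ℂ, Continuous g →
      MemLp g 2 (volume.restrict (Set.Ioc 0 (4 * Real.pi))) := fun g hg => by
    rw [memLp_two_iff_integrable_sq_norm hg.aestronglyMeasurable]
    exact (hg.norm.pow 2).integrableOn_Ioc
  have h1 := hasSum_sq_fourierCoeffOn hab (hmem f hfc)
  have h2 := hasSum_sq_fourierCoeffOn hab (hmem f' hf')
  have hper : f (4 * Real.pi) = f 0 := by
    have e1 := hanti 0
    have e2 := hanti (2 * Real.pi)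
    rw [zero_add] at e1
    rw [show 2 * Real.pi + 2 * Real.pi = 4 * Real.pi by ring, e1, neg_neg] at e2
    exact e2
  have hcoef : ∀ n : ℤ, (1 / 4) * ‖fourierCoeffOn hab f n‖ ^ 2 ≤ ‖fourierCoeffOn hab f' n‖ ^ 2 := by
    intro n
    rcases eq_or_ne n 0 with rfl | hn
    -- The zeroth coefficient is the mean: by antiperiodicity the integrals over the two halves of
    -- [0, 4π] cancel.
    · have : fourierCoeffOn hab f 0 = 0 := by
        rw [fourierCoeffOn_eq_integral]
        simp only [neg_zero, fourier_zero, one_smul]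
        have hi : ∀ a b : ℝ, IntervalIntegrable f volume a b := fun a b =>
          hfc.intervalIntegrable a b
        rw [← intervalIntegral.integral_add_adjacent_intervals (hi 0 (2 * Real.pi)) (hi _ _)]
        have : ∫ x in (2 * Real.pi)..(4 * Real.pi), f x = ∫ x in (0:ℝ)..(2 * Real.pi), f (x + 2 * Real.pi) := by
          rw [intervalIntegral.integral_comp_add_right]
          congr 1 <;> ring
        rw [this]
        simp [hanti]
      rw [this]
      simp
    -- On an interval of length 4π the frequencies are n/2, and f is 4π-periodic, so differentiation
    -- multiplies the n-th coefficient by in/2. The factor 1/4 is the case n² = 1.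
    · have := fourierCoeffOn_of_hasDerivAt hab hn (fun x _ => hf x) (hf'.intervalIntegrable _ _)
      rw [hper, sub_self, mul_zero, zero_sub] at this
      rw [this]
      have hn1 : (1 : ℝ) ≤ (n : ℝ) ^ 2 := by
        have : (1 : ℤ) ≤ n ^ 2 := by
          have := sq_pos_of_ne_zero hn
          omega
        exact_mod_cast this
      simp only [norm_mul, norm_neg, norm_div, norm_one, Complex.norm_I, mul_pow, div_pow, one_pow]
      have e1 : ‖((4 * Real.pi : ℝ) : ℂ) - ((0:ℝ):ℂ)‖ = 4 * Real.pi := by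
        rw [← Complex.ofReal_sub, Complex.norm_real, sub_zero, Real.norm_of_nonneg hab.le]
      rw [e1]
      have e2 : ‖(Real.pi : ℂ)‖ = Real.pi := by
        rw [Complex.norm_real, Real.norm_of_nonneg hpi.le]
      have e3 : ‖(n : ℂ)‖ ^ 2 = (n : ℝ) ^ 2 := by
        rw [Complex.norm_intCast, sq_abs]
      rw [e2, e3]
      have : (1:ℝ) / 4 * (1 / (‖(2:ℂ)‖ ^ 2 * Real.pi ^ 2 * 1 * n ^ 2) * ((4 * Real.pi) ^ 2 * ‖fourierCoeffOn hab f' n‖ ^ 2)) = ‖fourierCoeffOn hab f' n‖ ^ 2 / n ^ 2 := by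
        have : (n:ℝ) ≠ 0 := by exact_mod_cast hn
        rw [Complex.norm_ofNat]
        field_simp
        ring
      rw [this]
      exact div_le_self (by positivity) hn1
  have := hasSum_le hcoef (h1.mul_left (1 / 4)) h2
  rw [sub_zero, smul_eq_mul, smul_eq_mul] at this
  have h3 : (0:ℝ) < (4 * Real.pi)⁻¹ := by positivity
  nlinarith

theorem norm_sq_spinor (v : Spinor) : ‖v‖ ^ 2 = ‖v 0‖ ^ 2 + ‖v 1‖ ^ 2 := by
  rw [EuclideanSpace.norm_sq_eq, Fin.sum_univ_two]

/-- **Wirtinger's inequality** for antiperiodic spinor-valued functions. -/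
theorem wirtinger_antiperiodic_spinor {f f' : ℝ → Spinor} (hf : ∀ t, HasDerivAt f (f' t) t)
    (hf' : Continuous f') (hanti : ∀ t, f (t + 2 * Real.pi) = -f t) :
    (1 / 4) * ∫ t in (0 : ℝ)..(4 * Real.pi), ‖f t‖ ^ 2 ≤
      ∫ t in (0 : ℝ)..(4 * Real.pi), ‖f' t‖ ^ 2 := by
  have hfc : Continuous f := continuous_iff_continuousAt.2 fun t => (hf t).continuousAt
  have key : ∀ i : Fin 2, (1 / 4) * ∫ t in (0 : ℝ)..(4 * Real.pi), ‖f t i‖ ^ 2 ≤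
      ∫ t in (0 : ℝ)..(4 * Real.pi), ‖f' t i‖ ^ 2 := fun i => by
    refine wirtinger_antiperiodic (fun t => ?_) (by fun_prop) (fun t => by rw [hanti]; rfl)
    exact ((PiLp.proj (𝕜 := ℝ) 2 (fun _ : Fin 2 => ℂ) i).hasFDerivAt.comp_hasDerivAt t (hf t))
  have h0 := key 0
  have h1 := key 1
  simp only [norm_sq_spinor]
  have hii : ∀ (g : ℝ → Spinor) (i : Fin 2), Continuous g →
      IntervalIntegrable (fun t => ‖g t i‖ ^ 2) volume 0 (4 * Real.pi) := fun g i hg =>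
    Continuous.intervalIntegrable (by fun_prop) _ _
  rw [intervalIntegral.integral_add (hii f 0 hfc) (hii f 1 hfc),
    intervalIntegral.integral_add (hii f' 0 hf') (hii f' 1 hf')]
  linarith

/-! ### Rotations in coordinate planes and averaging over them -/

/-- The rotation by the angle `t` in the plane of the coordinates `j` and `k`. -/
noncomputable def rotation (j k : Fin 3) (t : ℝ) (x : Space) : Space :=
  x + ((Real.cos t - 1) * x j - Real.sin t * x k) • EuclideanSpace.single j 1 +
    (Real.sin t * x j + (Real.cos t - 1) * x k) • EuclideanSpace.single k 1

theorem norm_rotation {j k : Fin 3} (hjk : j ≠ k) (t : ℝ) (x : Space) :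
    ‖rotation j k t x‖ = ‖x‖ := by
  have hsc := Real.sin_sq_add_cos_sq t
  rw [← sq_eq_sq₀ (norm_nonneg _) (norm_nonneg _), EuclideanSpace.norm_sq_eq,
    EuclideanSpace.norm_sq_eq, Fin.sum_univ_three, Fin.sum_univ_three]
  simp only [Real.norm_eq_abs, sq_abs]
  fin_cases j <;> fin_cases k <;> simp [rotation] at hjk ⊢
  · linear_combination (x 0 ^ 2 + x 1 ^ 2) * hsc
  · linear_combination (x 0 ^ 2 + x 2 ^ 2) * hsc
  · linear_combination (x 1 ^ 2 + x 0 ^ 2) * hsc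
  · linear_combination (x 1 ^ 2 + x 2 ^ 2) * hsc
  · linear_combination (x 2 ^ 2 + x 0 ^ 2) * hsc
  · linear_combination (x 2 ^ 2 + x 1 ^ 2) * hsc

theorem measurePreserving_rotation {j k : Fin 3} (hjk : j ≠ k) (t : ℝ) :
    MeasurePreserving (rotation j k t) volume volume := by
  let A : Space →ₗᵢ[ℝ] Space :=
    { toFun := rotation j k t
      map_add' := fun x y => by
        simp only [rotation, PiLp.add_apply]
        module
      map_smul' := fun c x => by
        simp only [rotation, PiLp.smul_apply, smul_eq_mul, RingHom.id_apply]
        module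
      norm_map' := norm_rotation hjk t }
  exact (A.toLinearIsometryEquiv rfl).measurePreserving

theorem rotation_add_two_pi (j k : Fin 3) (t : ℝ) (x : Space) :
    rotation j k (t + 2 * Real.pi) x = rotation j k t x := by
  simp [rotation]

theorem hasDerivAt_rotation {j k : Fin 3} (hjk : j ≠ k) (t : ℝ) (x : Space) :
    HasDerivAt (fun t => rotation j k t x)
      ((rotation j k t x) j • EuclideanSpace.single k 1 -
        (rotation j k t x) k • EuclideanSpace.single j 1) t := by
  have h1 : HasDerivAt (fun t => (Real.cos t - 1) * x j - Real.sin t * x k)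
      (-Real.sin t * x j - Real.cos t * x k) t :=
    (((Real.hasDerivAt_cos t).sub_const 1).mul_const _).sub ((Real.hasDerivAt_sin t).mul_const _)
  have h2 : HasDerivAt (fun t => Real.sin t * x j + (Real.cos t - 1) * x k)
      (Real.cos t * x j + -Real.sin t * x k) t :=
    ((Real.hasDerivAt_sin t).mul_const _).add (((Real.hasDerivAt_cos t).sub_const 1).mul_const _)
  have h := ((h1.smul_const (EuclideanSpace.single j (1 : ℝ))).const_add x).add
    (h2.smul_const (EuclideanSpace.single k (1 : ℝ)))
  refine h.congr_deriv ?_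
  have hjk' := hjk.symm
  have ej : rotation j k t x j = Real.cos t * x j - Real.sin t * x k := by
    simp [rotation, hjk]
    ring
  have ek : rotation j k t x k = Real.sin t * x j + Real.cos t * x k := by
    simp [rotation, hjk']
    ring
  rw [ej, ek]
  module

theorem continuous_rotation (j k : Fin 3) :
    Continuous fun p : Space × ℝ => rotation j k p.2 p.1 := by
  unfold rotation
  fun_prop

/-- Averaging over rotations preserves integrals. -/
theorem integral_integral_rotation {j k : Fin 3} (hjk : j ≠ k) {G : Space → ℝ}
    (hG : Continuous G) (hGc : HasCompactSupport G) :
    ∫ x, ∫ t in (0 : ℝ)..(4 * Real.pi), G (rotation j k t x) = 4 * Real.pi * ∫ x, G x := by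
  have hab : (0 : ℝ) ≤ 4 * Real.pi := by positivity
  simp only [intervalIntegral.integral_of_le hab]
  have hGi : Integrable G := hG.integrable_of_hasCompactSupport hGc
  have hi : Integrable (fun p : Space × ℝ => G (rotation j k p.2 p.1))
      (volume.prod (volume.restrict (Set.Ioc 0 (4 * Real.pi)))) := by
    have hm : Continuous fun p : Space × ℝ => G (rotation j k p.2 p.1) :=
      hG.comp (continuous_rotation j k)
    rw [integrable_prod_iff' hm.aestronglyMeasurable]
    refine ⟨Eventually.of_forall fun t =>
      (measurePreserving_rotation hjk t).integrable_comp_of_integrable hGi, ?_⟩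
    have : ∀ t, ∫ x, ‖G (rotation j k t x)‖ = ∫ x, ‖G x‖ := fun t => by
      have hm := measurePreserving_rotation hjk t
      have := integral_map (μ := volume) hm.measurable.aemeasurable (f := fun x => ‖G x‖)
        hG.norm.aestronglyMeasurable
      rw [hm.map_eq] at this
      exact this.symm
    simp only [this]
    exact integrable_const _
  rw [integral_integral_swap hi]
  have : ∀ t, ∫ x, G (rotation j k t x) = ∫ x, G x := fun t => by
    have hm := measurePreserving_rotation hjk t
    have := integral_map (μ := volume) hm.measurable.aemeasurable (f := G)
      hG.aestronglyMeasurable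
    rw [hm.map_eq] at this
    exact this.symm
  simp only [this]
  simp [hab]

/-! ### Half-integer angular momentum -/

/-- The angular derivative `x_j ∂_k φ - x_k ∂_j φ`. -/
noncomputable def angularDeriv (j k : Fin 3) (φ : Space → Spinor) (x : Space) : Spinor :=
  x j • fderiv ℝ φ x (EuclideanSpace.single k 1) - x k • fderiv ℝ φ x (EuclideanSpace.single j 1)

theorem norm_sq_add_spinor (a b : Spinor) :
    ‖a + b‖ ^ 2 = ‖a‖ ^ 2 + 2 * (inner ℂ a b).re + ‖b‖ ^ 2 := by
  have := norm_add_sq (𝕜 := ℂ) a b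
  simpa using this

theorem IsTestSpinor.eq_zero {φ : Space → Spinor} (_ : IsTestSpinor φ) {x : Space}
    (hx : x ∉ tsupport φ) : φ x = 0 :=
  image_eq_zero_of_notMem_tsupport hx

theorem IsTestSpinor.fderiv_eq_zero {φ : Space → Spinor} (_ : IsTestSpinor φ) {x : Space}
    (hx : x ∉ tsupport φ) : fderiv ℝ φ x = 0 := by
  by_contra h
  exact hx (support_fderiv_subset ℝ h)

theorem IsTestSpinor.continuous_fderiv_apply {φ : Space → Spinor} (hφ : IsTestSpinor φ)
    (v : Space) : Continuous fun x => fderiv ℝ φ x v :=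
  (hφ.1.continuous_fderiv (by simp)).clm_apply continuous_const

/-- The square of a component of the total angular momentum is at least `1/4`. -/
theorem integral_angularMomentum_nonneg {j k : Fin 3} (hjk : j ≠ k) {τ : Spinor →L[ℂ] Spinor}
    (hτ : ∀ a, τ (τ a) = -a) (hτ' : ∀ a b, (inner ℂ (τ a) b).re = -(inner ℂ a (τ b)).re)
    {W : ℝ → ℝ} (hW : Continuous W) (hW0 : ∀ s, 0 ≤ W s) {φ : Space → Spinor}
    (hφ : IsTestSpinor φ) :
    0 ≤ ∫ x, W ‖x‖ * (‖angularDeriv j k φ x‖ ^ 2 - (inner ℂ (φ x) (τ (angularDeriv j k φ x))).re) := by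
  have hnτ : ∀ a, ‖τ a‖ ^ 2 = ‖a‖ ^ 2 := fun a => by
    have h := hτ' a (τ a)
    rw [hτ, inner_neg_right, Complex.neg_re, neg_neg] at h
    rw [← inner_self_eq_norm_sq (𝕜 := ℂ), ← inner_self_eq_norm_sq (𝕜 := ℂ)]
    exact h
  have hτ0 : ∀ a, (inner ℂ a (τ a)).re = 0 := fun a => by
    have h := hτ' a a
    have h2 : (inner ℂ (τ a) a).re = (inner ℂ a (τ a)).re :=
      inner_re_symm (𝕜 := ℂ) (τ a) a
    linarith
  -- Since τ² = -1, the map cos t + (sin t)τ is exp(tτ), an isometry because τ is skew.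
  have hU : ∀ (t : ℝ) (a : Spinor), ‖Real.cos t • a + Real.sin t • τ a‖ ^ 2 = ‖a‖ ^ 2 := fun t a => by
    rw [norm_sq_add_spinor, norm_smul, norm_smul, mul_pow, mul_pow, hnτ, ← Complex.coe_smul,
      ← Complex.coe_smul, inner_smul_left, inner_smul_right, Complex.conj_ofReal,
      Complex.re_ofReal_mul, Complex.re_ofReal_mul, hτ0, Real.norm_eq_abs, Real.norm_eq_abs,
      sq_abs, sq_abs]
    linear_combination ‖a‖ ^ 2 * Real.sin_sq_add_cos_sq t
  have hd : Continuous (angularDeriv j k φ) := by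
    have h1 := hφ.continuous_fderiv_apply (EuclideanSpace.single j 1)
    have h2 := hφ.continuous_fderiv_apply (EuclideanSpace.single k 1)
    unfold angularDeriv
    fun_prop
  have hφc : Continuous φ := hφ.1.continuous
  -- Completing the square: skewness of τ turns the mixed term of |Λφ + τφ/2|² into -Re⟨φ, τΛφ⟩,
  -- where Λ is the angular derivative.
  set G : Space → ℝ := fun x => W ‖x‖ *
    (‖angularDeriv j k φ x + (1 / 2 : ℝ) • τ (φ x)‖ ^ 2 - (1 / 4) * ‖φ x‖ ^ 2) with hG
  have hGc : Continuous G := by fun_prop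
  have hGs : HasCompactSupport G := by
    refine HasCompactSupport.intro hφ.2 fun x hx => ?_
    simp [hG, angularDeriv, hφ.eq_zero hx, hφ.fderiv_eq_zero hx]
  have hGeq : ∀ x, G x = W ‖x‖ *
      (‖angularDeriv j k φ x‖ ^ 2 - (inner ℂ (φ x) (τ (angularDeriv j k φ x))).re) := fun x => by
    simp only [hG]
    rw [norm_sq_add_spinor, norm_smul, mul_pow, hnτ, ← Complex.coe_smul, inner_smul_right,
      Complex.re_ofReal_mul]
    have h1 := hτ' (angularDeriv j k φ x) (φ x)
    have h2 : (inner ℂ (τ (angularDeriv j k φ x)) (φ x)).re =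
        (inner ℂ (φ x) (τ (angularDeriv j k φ x))).re :=
      inner_re_symm (𝕜 := ℂ) (τ (angularDeriv j k φ x)) (φ x)
    have h3 : (inner ℂ (angularDeriv j k φ x) (τ (φ x))).re =
      -(inner ℂ (φ x) (τ (angularDeriv j k φ x))).re := by
      rw [h2] at h1
      exact (neg_eq_iff_eq_neg.2 h1).symm
    rw [h3, Real.norm_of_nonneg (by norm_num)]
    ring
  simp only [← hGeq]
  have havg := integral_integral_rotation hjk hGc hGs
  have hpos : 0 ≤ ∫ x, ∫ t in (0 : ℝ)..(4 * Real.pi), G (rotation j k t x) := by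
    refine integral_nonneg fun x => ?_
    have hcr : Continuous fun t => rotation j k t x :=
      (continuous_rotation j k).comp (Continuous.prodMk_right x)
    have hdiff : ∀ t, HasDerivAt (fun t => φ (rotation j k t x))
        (angularDeriv j k φ (rotation j k t x)) t := fun t => by
      have h := ((hφ.1.differentiable (by simp) _).hasFDerivAt).comp_hasDerivAt t
        (hasDerivAt_rotation hjk t x)
      exact h.congr_deriv (by simp [angularDeriv])
    have hc2 : ∀ t : ℝ, HasDerivAt (fun t : ℝ => Real.cos (t / 2)) (-Real.sin (t / 2) * (1 / 2)) t :=
      fun t => HasDerivAt.cos ((hasDerivAt_id' t).div_const 2)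
    have hs2 : ∀ t : ℝ, HasDerivAt (fun t : ℝ => Real.sin (t / 2)) (Real.cos (t / 2) * (1 / 2)) t :=
      fun t => HasDerivAt.sin ((hasDerivAt_id' t).div_const 2)
    -- The spinor is rotated by half the angle of space: f(t) = exp(tτ/2) φ(Rₜx) changes sign when t
    -- grows by 2π, and f'(t) = exp(tτ/2)(Λφ + τφ/2)(Rₜx). Wirtinger along the orbit is the bound
    -- 1/4.
    have hw := wirtinger_antiperiodic_spinor
      (f := fun t => Real.cos (t / 2) • φ (rotation j k t x) +
        Real.sin (t / 2) • τ (φ (rotation j k t x)))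
      (f' := fun t => Real.cos (t / 2) • (angularDeriv j k φ (rotation j k t x) +
          (1 / 2 : ℝ) • τ (φ (rotation j k t x))) +
        Real.sin (t / 2) • τ (angularDeriv j k φ (rotation j k t x) +
          (1 / 2 : ℝ) • τ (φ (rotation j k t x))))
      (fun t => by
        have h1 := (hc2 t).smul (hdiff t)
        have h2 := (hs2 t).smul (((τ.restrictScalars ℝ).hasFDerivAt).comp_hasDerivAt t (hdiff t))
        refine (h1.add h2).congr_deriv ?_
        have : τ ((1 / 2 : ℝ) • τ (φ (rotation j k t x))) = -((1 / 2 : ℝ) • φ (rotation j k t x)) := by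
          rw [← Complex.coe_smul, map_smul, hτ, Complex.coe_smul, smul_neg]
        rw [map_add, this]
        simp only [ContinuousLinearMap.coe_restrictScalars', Function.comp]
        module)
      (by fun_prop)
      (fun t => by
        simp only [rotation_add_two_pi]
        rw [show (t + 2 * Real.pi) / 2 = t / 2 + Real.pi by ring, Real.cos_add_pi, Real.sin_add_pi]
        module)
    simp only [hU] at hw
    simp only [hG, norm_rotation hjk]
    rw [intervalIntegral.integral_const_mul, intervalIntegral.integral_sub
      (Continuous.intervalIntegrable (by fun_prop) _ _)
      (Continuous.intervalIntegrable (by fun_prop) _ _), intervalIntegral.integral_const_mul]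
    exact mul_nonneg (hW0 _) (by linarith)
  rw [havg] at hpos
  have : (0 : ℝ) < 4 * Real.pi := by positivity
  exact nonneg_of_mul_nonneg_right hpos this

/-! ### Pauli algebra and pointwise identities -/

/-- The Pauli matrix `σ_k` as a continuous linear map on spinors. -/
noncomputable def sigma (k : Fin 3) : Spinor →L[ℂ] Spinor :=
  LinearMap.toContinuousLinearMap (Matrix.toEuclideanLin (pauli k))

theorem sigmaGrad_eq (φ : Space → Spinor) (x : Space) :
    sigmaGrad φ x = ∑ k : Fin 3, sigma k (fderiv ℝ φ x (EuclideanSpace.single k 1)) := rfl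

theorem sigma_sigma_self (k : Fin 3) (a : Spinor) : sigma k (sigma k a) = a := by
  ext i
  fin_cases k <;> fin_cases i <;>
    simp [sigma, pauli, Matrix.toLpLin_apply, dotProduct, Fin.sum_univ_two] <;>
    ring_nf <;> simp

theorem sigma_anticomm {j k : Fin 3} (hjk : j ≠ k) (a : Spinor) :
    sigma j (sigma k a) = -sigma k (sigma j a) := by
  ext i
  fin_cases j <;> fin_cases k <;> fin_cases i <;>
    simp [sigma, pauli, Matrix.toLpLin_apply, dotProduct, Fin.sum_univ_two] at hjk ⊢ <;> ring

theorem inner_sigma_left (k : Fin 3) (a b : Spinor) :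
    inner ℂ (sigma k a) b = inner ℂ a (sigma k b) := by
  fin_cases k <;>
    simp [sigma, pauli, Matrix.toLpLin_apply, dotProduct, Fin.sum_univ_two,
      PiLp.inner_apply] <;> ring

theorem norm_sigma (k : Fin 3) (a : Spinor) : ‖sigma k a‖ = ‖a‖ := by
  rw [← sq_eq_sq₀ (norm_nonneg _) (norm_nonneg _), ← inner_self_eq_norm_sq (𝕜 := ℂ),
    ← inner_self_eq_norm_sq (𝕜 := ℂ), inner_sigma_left, sigma_sigma_self]

/-- The product `σ_j σ_k`. -/
noncomputable def sigmaMul (j k : Fin 3) : Spinor →L[ℂ] Spinor := (sigma j).comp (sigma k)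

/-- Anticommutation makes σⱼσₖ a complex structure; together with the skewness proved next, it can
serve as τ in `integral_angularMomentum_nonneg`. -/
theorem sigmaMul_sq {j k : Fin 3} (hjk : j ≠ k) (a : Spinor) :
    sigmaMul j k (sigmaMul j k a) = -a := by
  simp only [sigmaMul, ContinuousLinearMap.comp_apply]
  rw [sigma_anticomm hjk.symm, sigma_sigma_self, map_neg, sigma_sigma_self]

theorem re_inner_sigmaMul_left {j k : Fin 3} (hjk : j ≠ k) (a b : Spinor) :
    (inner ℂ (sigmaMul j k a) b).re = -(inner ℂ a (sigmaMul j k b)).re := by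
  simp only [sigmaMul, ContinuousLinearMap.comp_apply]
  rw [inner_sigma_left, inner_sigma_left, sigma_anticomm hjk.symm, inner_neg_right, Complex.neg_re]

theorem norm_sq_sum_sigma (a : Fin 3 → Spinor) :
    ‖∑ k, sigma k (a k)‖ ^ 2 = ∑ k, ‖a k‖ ^ 2 + 2 * (inner ℂ (a 0) (sigmaMul 0 1 (a 1))).re +
      2 * (inner ℂ (a 0) (sigmaMul 0 2 (a 2))).re + 2 * (inner ℂ (a 1) (sigmaMul 1 2 (a 2))).re := by
  simp only [Fin.sum_univ_three, sigmaMul, ContinuousLinearMap.comp_apply]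
  rw [norm_sq_add_spinor, norm_sq_add_spinor, inner_add_left, Complex.add_re]
  simp only [norm_sigma, inner_sigma_left]
  ring

/-- Lagrange's identity. With a = ∇φ it splits the gradient into the radial derivative and the three
angular derivatives. -/
theorem norm_sq_mul_sum_norm_sq (x : Space) (a : Fin 3 → Spinor) :
    ‖x‖ ^ 2 * ∑ k, ‖a k‖ ^ 2 = ‖∑ k, x k • a k‖ ^ 2 + ‖x 0 • a 1 - x 1 • a 0‖ ^ 2 +
      ‖x 0 • a 2 - x 2 • a 0‖ ^ 2 + ‖x 1 • a 2 - x 2 • a 1‖ ^ 2 := by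
  simp only [EuclideanSpace.real_norm_sq_eq, Fin.sum_univ_three, norm_sq_spinor, Complex.sq_norm,
    Complex.normSq_apply, PiLp.add_apply, PiLp.sub_apply, PiLp.smul_apply, Complex.add_re,
    Complex.add_im, Complex.sub_re, Complex.sub_im, Complex.smul_re, Complex.smul_im, smul_eq_mul]
  ring

theorem space_eq_sum (x : Space) :
    x = ∑ k, x k • (EuclideanSpace.single k (1 : ℝ) : Space) := by
  ext i
  fin_cases i <;> simp [Fin.sum_univ_three]

/-! ### Regularized norm and integrations by parts -/

/-- The regularized norm `√(|x|² + ε²)`. -/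
noncomputable def softNorm (ε : ℝ) (x : Space) : ℝ := √(‖x‖ ^ 2 + ε ^ 2)

theorem softNorm_pos {ε : ℝ} (hε : 0 < ε) (x : Space) : 0 < softNorm ε x := by
  unfold softNorm
  positivity

theorem softNorm_sq (ε : ℝ) (x : Space) : softNorm ε x ^ 2 = ‖x‖ ^ 2 + ε ^ 2 :=
  Real.sq_sqrt (by positivity)

theorem contDiff_softNorm {ε : ℝ} (hε : 0 < ε) : ContDiff ℝ ∞ (softNorm ε) := by
  unfold softNorm
  exact ((contDiff_norm_sq ℝ).add contDiff_const).sqrt fun x => by positivity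

theorem fderiv_softNorm {ε : ℝ} (hε : 0 < ε) (x : Space) (k : Fin 3) :
    fderiv ℝ (softNorm ε) x (EuclideanSpace.single k 1) = x k / softNorm ε x := by
  have h1 := ((hasStrictFDerivAt_norm_sq x).hasFDerivAt.add_const (ε ^ 2)).sqrt
    (by positivity : ‖x‖ ^ 2 + ε ^ 2 ≠ 0)
  have h2 : HasFDerivAt (softNorm ε) _ x := h1
  rw [h2.fderiv]
  have := softNorm_pos hε x
  simp [softNorm, EuclideanSpace.inner_single_right]
  field_simp

theorem IsTestSpinor.integrable_of_eq_zero {E : Type*} [NormedAddCommGroup E] {φ : Space → Spinor}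
    (hφ : IsTestSpinor φ) {G : Space → E} (hG : Continuous G)
    (h0 : ∀ x, x ∉ tsupport φ → G x = 0) : Integrable G :=
  hG.integrable_of_hasCompactSupport (HasCompactSupport.intro hφ.2 h0)

theorem integral_mul_fderiv {f g : Space → ℝ} (hf : ContDiff ℝ 1 f) (hg : ContDiff ℝ 1 g)
    (hgc : HasCompactSupport g) (v : Space) :
    ∫ x, f x * fderiv ℝ g x v = -∫ x, fderiv ℝ f x v * g x := by
  have hf' : Continuous fun x => fderiv ℝ f x v :=
    (hf.continuous_fderiv one_ne_zero).clm_apply continuous_const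
  have hg' : Continuous fun x => fderiv ℝ g x v :=
    (hg.continuous_fderiv one_ne_zero).clm_apply continuous_const
  refine integral_mul_fderiv_eq_neg_fderiv_mul_of_integrable ?_ ?_ ?_
    (fun x _ => hf.differentiable one_ne_zero x) (fun x _ => hg.differentiable one_ne_zero x)
  · exact (hf'.mul hg.continuous).integrable_of_hasCompactSupport hgc.mul_left
  · exact (hf.continuous.mul hg').integrable_of_hasCompactSupport (hgc.fderiv_apply ℝ v).mul_left
  · exact (hf.continuous.mul hg.continuous).integrable_of_hasCompactSupport hgc.mul_left

theorem contDiff_re_inner {f g : Space → Spinor} {n : WithTop ℕ∞} (hf : ContDiff ℝ n f)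
    (hg : ContDiff ℝ n g) : ContDiff ℝ n fun x => (inner ℂ (f x) (g x)).re :=
  Complex.reCLM.contDiff.comp (hf.inner ℂ hg)

theorem fderiv_re_inner {f g : Space → Spinor} {x : Space} (hf : DifferentiableAt ℝ f x)
    (hg : DifferentiableAt ℝ g x) (v : Space) :
    fderiv ℝ (fun x => (inner ℂ (f x) (g x)).re) x v =
      (inner ℂ (f x) (fderiv ℝ g x v)).re + (inner ℂ (fderiv ℝ f x v) (g x)).re := by
  have h := (Complex.reCLM.hasFDerivAt (x := inner ℂ (f x) (g x))).comp x
    (hf.inner ℂ hg).hasFDerivAt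
  have h2 : HasFDerivAt (fun x => (inner ℂ (f x) (g x)).re) _ x := h
  rw [h2.fderiv, ContinuousLinearMap.comp_apply, fderiv_inner_apply ℂ hf hg]
  simp

theorem IsTestSpinor.contDiff_fderiv_apply {φ : Space → Spinor} (hφ : IsTestSpinor φ)
    (v : Space) : ContDiff ℝ ∞ fun x => fderiv ℝ φ x v :=
  (hφ.1.fderiv_right (by simp)).clm_apply contDiff_const

theorem IsTestSpinor.fderiv_fderiv_comm {φ : Space → Spinor} (hφ : IsTestSpinor φ)
    (x v w : Space) :
    fderiv ℝ (fun y => fderiv ℝ φ y v) x w = fderiv ℝ (fun y => fderiv ℝ φ y w) x v := by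
  have hd : DifferentiableAt ℝ (fderiv ℝ φ) x :=
    ((hφ.1.fderiv_right (m := ∞) (by simp)).differentiable (by simp)) x
  have h := (hφ.1.contDiffAt (x := x)).isSymmSndFDerivAt
    (by simpa using WithTop.coe_le_coe.2 (le_top : (2 : ℕ∞) ≤ ⊤))
  rw [fderiv_clm_apply hd (by fun_prop), fderiv_clm_apply hd (by fun_prop)]
  simpa using h w v

/-- Integration by parts for the cross terms of `|σ·∇φ|²` with a radial weight. -/
theorem integral_cross_term {j k : Fin 3} (hjk : j ≠ k) {m w : Space → ℝ} (hm : ContDiff ℝ 1 m)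
    (hw : ∀ x i, fderiv ℝ m x (EuclideanSpace.single i 1) = w x * x i)
    (hwc : Continuous w) {φ : Space → Spinor} (hφ : IsTestSpinor φ) :
    ∫ x, m x * (2 * (inner ℂ (fderiv ℝ φ x (EuclideanSpace.single j 1))
      (sigmaMul j k (fderiv ℝ φ x (EuclideanSpace.single k 1)))).re) =
    -∫ x, w x * (inner ℂ (φ x) (sigmaMul j k (angularDeriv j k φ x))).re := by
  set D : Fin 3 → Space → Spinor := fun i x => fderiv ℝ φ x (EuclideanSpace.single i 1) with hD
  set τ := sigmaMul j k with hτ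
  have hDc : ∀ i, ContDiff ℝ 1 (D i) := fun i =>
    (hφ.contDiff_fderiv_apply _).of_le (by exact_mod_cast le_top)
  have hφ1 : ContDiff ℝ 1 φ := hφ.1.of_le (by exact_mod_cast le_top)
  have hτD : ∀ i, ContDiff ℝ 1 fun x => τ (D i x) := fun i =>
    (τ.restrictScalars ℝ).contDiff.comp (hDc i)
  have hgc : ∀ i, ContDiff ℝ 1 fun x => (inner ℂ (φ x) (τ (D i x))).re := fun i =>
    contDiff_re_inner hφ1 (hτD i)
  have hgs : ∀ i, HasCompactSupport fun x => (inner ℂ (φ x) (τ (D i x))).re := fun i =>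
    HasCompactSupport.intro hφ.2 fun x hx => by simp [hφ.eq_zero hx]
  have hdτ : ∀ i x v, fderiv ℝ (fun x => τ (D i x)) x v = τ (fderiv ℝ (D i) x v) := fun i x v => by
    have h := ((τ.restrictScalars ℝ).hasFDerivAt (x := D i x)).comp x
      ((hDc i).differentiable one_ne_zero x).hasFDerivAt
    have h2 : HasFDerivAt (fun x => τ (D i x)) _ x := h
    rw [h2.fderiv]
    rfl
  -- Each cross term is a divergence: second derivatives cancel by symmetry, and skewness of τ makes
  -- the two first-order products add up.
  have hpt : ∀ x, 2 * (inner ℂ (D j x) (τ (D k x))).re =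
      fderiv ℝ (fun x => (inner ℂ (φ x) (τ (D k x))).re) x (EuclideanSpace.single j 1) -
      fderiv ℝ (fun x => (inner ℂ (φ x) (τ (D j x))).re) x (EuclideanSpace.single k 1) := fun x => by
    rw [fderiv_re_inner (hφ1.differentiable one_ne_zero x) ((hτD k).differentiable one_ne_zero x),
      fderiv_re_inner (hφ1.differentiable one_ne_zero x) ((hτD j).differentiable one_ne_zero x),
      hdτ, hdτ, hφ.fderiv_fderiv_comm x (EuclideanSpace.single j 1) (EuclideanSpace.single k 1)]
    have h1 := re_inner_sigmaMul_left hjk (D k x) (D j x)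
    have h2 : (inner ℂ (τ (D k x)) (D j x)).re = (inner ℂ (D j x) (τ (D k x))).re :=
      inner_re_symm (𝕜 := ℂ) (τ (D k x)) (D j x)
    rw [← hτ, h2] at h1
    change _ = _ + (inner ℂ (D j x) (τ (D k x))).re - (_ + (inner ℂ (D k x) (τ (D j x))).re)
    linarith
  have hint : ∀ i v, Integrable fun x =>
      m x * fderiv ℝ (fun x => (inner ℂ (φ x) (τ (D i x))).re) x v := fun i v =>
    (hm.continuous.mul (((hgc i).continuous_fderiv one_ne_zero).clm_apply
      continuous_const)).integrable_of_hasCompactSupport ((hgs i).fderiv_apply ℝ v).mul_left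
  have hint2 : ∀ i l, Integrable fun x => w x * x l * (inner ℂ (φ x) (τ (D i x))).re := fun i l => by
    have := (hgc i).continuous
    exact Continuous.integrable_of_hasCompactSupport (by fun_prop) (hgs i).mul_left
  calc _ = ∫ x, (m x * fderiv ℝ (fun x => (inner ℂ (φ x) (τ (D k x))).re) x
        (EuclideanSpace.single j 1) - m x * fderiv ℝ (fun x => (inner ℂ (φ x) (τ (D j x))).re) x
        (EuclideanSpace.single k 1)) := by
        refine integral_congr_ae (Eventually.of_forall fun x => ?_)
        change m x * (2 * (inner ℂ (D j x) (τ (D k x))).re) = _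
        rw [hpt, mul_sub]
    _ = -∫ x, (w x * x j * (inner ℂ (φ x) (τ (D k x))).re -
          w x * x k * (inner ℂ (φ x) (τ (D j x))).re) := by
        rw [integral_sub (hint _ _) (hint _ _), integral_mul_fderiv hm (hgc _) (hgs _),
          integral_mul_fderiv hm (hgc _) (hgs _), integral_sub (hint2 _ _) (hint2 _ _)]
        simp only [hw]
        ring
    _ = _ := by
        congr 1
        refine integral_congr_ae (Eventually.of_forall fun x => ?_)
        change _ = w x * (inner ℂ (φ x) (τ (x j • D k x - x k • D j x))).re
        rw [← Complex.coe_smul, ← Complex.coe_smul, map_sub, map_smul, map_smul, inner_sub_right,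
          inner_smul_right, inner_smul_right, Complex.sub_re, Complex.re_ofReal_mul,
          Complex.re_ofReal_mul]
        ring

theorem IsTestSpinor.continuous_sigmaGrad {φ : Space → Spinor} (hφ : IsTestSpinor φ) :
    Continuous (sigmaGrad φ) := by
  have h := fun k : Fin 3 => hφ.continuous_fderiv_apply (EuclideanSpace.single k 1)
  have : sigmaGrad φ = fun x => ∑ k : Fin 3, sigma k (fderiv ℝ φ x (EuclideanSpace.single k 1)) :=
    funext fun x => sigmaGrad_eq φ x
  rw [this]
  fun_prop

theorem IsTestSpinor.sigmaGrad_eq_zero {φ : Space → Spinor} (hφ : IsTestSpinor φ) {x : Space}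
    (hx : x ∉ tsupport φ) : sigmaGrad φ x = 0 := by
  simp [sigmaGrad_eq, hφ.fderiv_eq_zero hx]

theorem fderiv_self_eq_sum (φ : Space → Spinor) (x : Space) :
    fderiv ℝ φ x x = ∑ k, x k • fderiv ℝ φ x (EuclideanSpace.single k 1) := by
  conv_lhs => rw [show fderiv ℝ φ x x = fderiv ℝ φ x
    (∑ k, x k • (EuclideanSpace.single k (1 : ℝ) : Space)) from by rw [← space_eq_sum x]]
  simp

/-- Integration by parts for the radial derivative. -/
theorem integral_radial_term {ε : ℝ} (hε : 0 < ε) {φ : Space → Spinor} (hφ : IsTestSpinor φ) :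
    ∫ x, 2 / softNorm ε x * (inner ℂ (φ x) (fderiv ℝ φ x x)).re =
      -∫ x, (3 / softNorm ε x - ‖x‖ ^ 2 / softNorm ε x ^ 3) * ‖φ x‖ ^ 2 := by
  have hφ1 : ContDiff ℝ 1 φ := hφ.1.of_le (by exact_mod_cast le_top)
  have hr0 := fun x => (softNorm_pos hε x).ne'
  have hrs : ContDiff ℝ 1 (softNorm ε) := (contDiff_softNorm hε).of_le (by exact_mod_cast le_top)
  have hrc := hrs.continuous
  have hg : ContDiff ℝ 1 fun x => (inner ℂ (φ x) (φ x)).re := contDiff_re_inner hφ1 hφ1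
  have hgs : HasCompactSupport fun x => (inner ℂ (φ x) (φ x)).re :=
    HasCompactSupport.intro hφ.2 fun x hx => by simp [hφ.eq_zero hx]
  have hgn : ∀ x, (inner ℂ (φ x) (φ x)).re = ‖φ x‖ ^ 2 := fun x =>
    inner_self_eq_norm_sq (𝕜 := ℂ) (φ x)
  have hf : ∀ k : Fin 3, ContDiff ℝ 1 fun x : Space => x k / softNorm ε x := fun k => by
    have : ContDiff ℝ 1 fun x : Space => x k := by fun_prop
    exact this.div hrs hr0
  have hf' : ∀ (k : Fin 3) x, fderiv ℝ (fun x : Space => x k / softNorm ε x) x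
      (EuclideanSpace.single k 1) = 1 / softNorm ε x - x k ^ 2 / softNorm ε x ^ 3 := fun k x => by
    have h1 : HasFDerivAt (fun x : Space => x k) (EuclideanSpace.proj (𝕜 := ℝ) k : Space →L[ℝ] ℝ) x :=
      (EuclideanSpace.proj (𝕜 := ℝ) k : Space →L[ℝ] ℝ).hasFDerivAt
    have h2 := (hrs.differentiable one_ne_zero x).hasFDerivAt
    have h3 := h1.mul ((hasDerivAt_inv (hr0 x)).comp_hasFDerivAt x h2)
    have h4 : HasFDerivAt (fun x : Space => x k / softNorm ε x) _ x := h3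
    rw [h4.fderiv]
    simp [fderiv_softNorm hε]
    have := hr0 x
    field_simp
    ring
  have hk : ∀ k : Fin 3, ∫ x, x k / softNorm ε x * fderiv ℝ (fun x => (inner ℂ (φ x) (φ x)).re) x
      (EuclideanSpace.single k 1) =
      -∫ x, (1 / softNorm ε x - x k ^ 2 / softNorm ε x ^ 3) * ‖φ x‖ ^ 2 := fun k => by
    rw [integral_mul_fderiv (hf k) hg hgs]
    simp only [hf', hgn]
  -- Here 2 Re⟨φ, x·∇φ⟩ = x·∇|φ|², so the integral pairs ∇|φ|² with the field x/r, r being the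
  -- regularized norm; its divergence is 3/r - |x|²/r³.
  have hpt : ∀ x, 2 / softNorm ε x * (inner ℂ (φ x) (fderiv ℝ φ x x)).re =
      ∑ k : Fin 3, x k / softNorm ε x * fderiv ℝ (fun x => (inner ℂ (φ x) (φ x)).re) x
      (EuclideanSpace.single k 1) := fun x => by
    have hd := hφ1.differentiable one_ne_zero x
    have hsym : ∀ a b : Spinor, (inner ℂ a b).re = (inner ℂ b a).re := fun a b =>
      inner_re_symm (𝕜 := ℂ) a b
    simp only [fderiv_re_inner hd hd, fderiv_self_eq_sum, inner_sum, Complex.re_sum,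
      Finset.mul_sum]
    refine Finset.sum_congr rfl fun k _ => ?_
    rw [hsym (fderiv ℝ φ x _) (φ x), ← Complex.coe_smul, inner_smul_right, Complex.re_ofReal_mul]
    ring
  have hi : ∀ k : Fin 3, Integrable fun x => x k / softNorm ε x *
      fderiv ℝ (fun x => (inner ℂ (φ x) (φ x)).re) x (EuclideanSpace.single k 1) := fun k =>
    ((hf k).continuous.mul ((hg.continuous_fderiv one_ne_zero).clm_apply
      continuous_const)).integrable_of_hasCompactSupport (hgs.fderiv_apply ℝ _).mul_left
  have hi2 : ∀ k : Fin 3, Integrable fun x =>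
      (1 / softNorm ε x - x k ^ 2 / softNorm ε x ^ 3) * ‖φ x‖ ^ 2 := fun k => by
    have hφc := hφ1.continuous
    refine hφ.integrable_of_eq_zero ?_ fun x hx => by simp [hφ.eq_zero hx]
    have : ∀ x, softNorm ε x ^ 3 ≠ 0 := fun x => pow_ne_zero _ (hr0 x)
    fun_prop (disch := assumption)
  simp only [hpt]
  rw [integral_finsetSum _ fun k _ => hi k]
  simp only [hk]
  rw [Finset.sum_neg_distrib, ← integral_finsetSum _ fun k _ => hi2 k]
  congr 1
  refine integral_congr_ae (Eventually.of_forall fun x => ?_)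
  simp only [EuclideanSpace.real_norm_sq_eq x, Fin.sum_univ_three]
  ring

/-! ### The Hardy-Dirac inequality -/

theorem integral_add_four {f g h k : Space → ℝ} (hf : Integrable f) (hg : Integrable g)
    (hh : Integrable h) (hk : Integrable k) :
    ∫ x, (f x + g x + h x + k x) = (∫ x, f x) + (∫ x, g x) + (∫ x, h x) + ∫ x, k x := by
  rw [← integral_add' hf hg, ← integral_add' (hf.add hg) hh,
    ← integral_add' ((hf.add hg).add hh) hk]
  rfl

theorem integral_sub_four {f g h k : Space → ℝ} (hf : Integrable f) (hg : Integrable g)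
    (hh : Integrable h) (hk : Integrable k) :
    ∫ x, (f x - g x - h x - k x) = (∫ x, f x) - (∫ x, g x) - (∫ x, h x) - ∫ x, k x := by
  rw [← integral_sub' hf hg, ← integral_sub' (hf.sub hg) hh,
    ← integral_sub' ((hf.sub hg).sub hh) hk]
  rfl

/-- Replacing a by its radial part b/r² bounds the right side below by (M/r²)b; then expand the
square (M√b/r - √c)²/M ≥ 0. In the application a = |∇φ|², b = |x·∇φ|², c = |φ|², s = |x|² and r is
the regularized norm. -/
theorem hardy_pointwise {r s a b c p M w : ℝ} (hr : 0 < r) (hM : 0 < M) (hs : s ≤ r ^ 2)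
    (hw : 0 ≤ w) (hwm : w * s ≤ M) (hb : b ≤ s * a) (ha : 0 ≤ a) (hb0 : 0 ≤ b)
    (hcp : p ^ 2 ≤ b * c) (hc : 0 ≤ c) :
    -(2 / r * p) - c / M ≤ (M - w * s) * a + w * b := by
  have h1 : M / r ^ 2 * b ≤ (M - w * s) * a + w * b := by
    have h2 : b ≤ r ^ 2 * a := hb.trans (by gcongr)
    have h3 : b / r ^ 2 ≤ a := by rwa [div_le_iff₀' (by positivity)]
    have h4 : (M - w * s) * (b / r ^ 2) ≤ (M - w * s) * a := by
      apply mul_le_mul_of_nonneg_left h3; linarith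
    have h5 : w * s * (b / r ^ 2) ≤ w * b := by
      rw [mul_assoc]
      gcongr
      rw [mul_div_assoc', div_le_iff₀ (by positivity), mul_comm]
      gcongr
    have : M / r ^ 2 * b = (M - w * s) * (b / r ^ 2) + w * s * (b / r ^ 2) := by ring
    linarith
  refine le_trans ?_ h1
  have h6 : |p| ≤ √b * √c := by
    rw [← Real.sqrt_mul hb0, ← Real.sqrt_sq_eq_abs]
    exact Real.sqrt_le_sqrt hcp
  have hb' := Real.sq_sqrt hb0
  have hc' := Real.sq_sqrt hc
  have h7 : 0 ≤ (M / r * √b - √c) ^ 2 / M := by positivity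
  have h8 : (M / r * √b - √c) ^ 2 / M = M / r ^ 2 * b - 2 / r * (√b * √c) + c / M := by
    rw [← hb', ← hc']
    simp only [Real.sqrt_sq (Real.sqrt_nonneg _)]
    field_simp
    ring
  have h9 : -(2 / r * p) ≤ 2 / r * (√b * √c) := by
    rw [← mul_neg]
    gcongr
    exact (neg_le_abs p).trans h6
  linarith

/-- The Hardy-Dirac inequality with a regularized Coulomb potential. -/
theorem hardy_dirac_softNorm {ε α : ℝ} (hε : 0 < ε) (hα : 0 < α) {φ : Space → Spinor}
    (hφ : IsTestSpinor φ) :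
    ∫ x, (1 / softNorm ε x - α) * ‖φ x‖ ^ 2 ≤
      ∫ x, softNorm ε x / (1 + α * softNorm ε x) * ‖sigmaGrad φ x‖ ^ 2 := by
  have hrp := softNorm_pos hε
  have hr0 := fun x => (hrp x).ne'
  have hq : ∀ x, 0 < 1 + α * softNorm ε x := fun x => by have := hrp x; positivity
  have hq0 := fun x => (hq x).ne'
  have hrs : ContDiff ℝ 1 (softNorm ε) := (contDiff_softNorm hε).of_le (by exact_mod_cast le_top)
  have hrc := hrs.continuous
  -- As a function of r = `softNorm ε x`, the weight m = r/(1 + αr) has 1/m = 1/r + α, which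
  -- produces the final -α. The factor w = m'(r)/r is chosen so that ∇m = w x.
  set m : Space → ℝ := fun x => softNorm ε x / (1 + α * softNorm ε x) with hm
  set w : Space → ℝ := fun x => 1 / (softNorm ε x * (1 + α * softNorm ε x) ^ 2) with hw
  have hmc : ContDiff ℝ 1 m := hrs.div (contDiff_const.add (contDiff_const.mul hrs)) hq0
  have hmcont := hmc.continuous
  have hwc : Continuous w := by
    have : ∀ x, softNorm ε x * (1 + α * softNorm ε x) ^ 2 ≠ 0 := fun x => by
      have := hr0 x
      have := hq0 x
      positivity
    fun_prop (disch := assumption)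
  have hdm : ∀ x i, fderiv ℝ m x (EuclideanSpace.single i 1) = w x * x i := fun x i => by
    have h2 := (hrs.differentiable one_ne_zero x).hasFDerivAt
    have h3 := h2.mul ((hasDerivAt_inv (hq0 x)).comp_hasFDerivAt x ((h2.const_mul α).const_add 1))
    have h4 : HasFDerivAt m _ x := h3
    rw [h4.fderiv]
    simp [fderiv_softNorm hε, hw]
    have := hr0 x
    have := hq0 x
    field_simp
    ring
  set D : Fin 3 → Space → Spinor := fun i x => fderiv ℝ φ x (EuclideanSpace.single i 1) with hD
  have hDc : ∀ i, Continuous (D i) := fun i => hφ.continuous_fderiv_apply _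
  have hD0 : ∀ i x, x ∉ tsupport φ → D i x = 0 := fun i x hx => by
    simp [hD, hφ.fderiv_eq_zero hx]
  have hφc : Continuous φ := hφ.1.continuous
  have hΛ : ∀ j k, Continuous (angularDeriv j k φ) := fun j k => by
    change Continuous fun x => x j • D k x - x k • D j x
    fun_prop
  have hang : ∀ j k : Fin 3, j ≠ k →
      0 ≤ ∫ x, w x * (‖angularDeriv j k φ x‖ ^ 2 -
        (inner ℂ (φ x) (sigmaMul j k (angularDeriv j k φ x))).re) := fun j k hjk => by
    have hs0 : ∀ s : ℝ, 0 < √(s ^ 2 + ε ^ 2) := fun s => by positivity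
    refine integral_angularMomentum_nonneg hjk (sigmaMul_sq hjk) (re_inner_sigmaMul_left hjk)
      (W := fun s => 1 / (√(s ^ 2 + ε ^ 2) * (1 + α * √(s ^ 2 + ε ^ 2)) ^ 2)) ?_ ?_ hφ
    · have : ∀ s : ℝ, √(s ^ 2 + ε ^ 2) * (1 + α * √(s ^ 2 + ε ^ 2)) ^ 2 ≠ 0 := fun s => by
        have := hs0 s
        positivity
      fun_prop (disch := assumption)
    · intro s
      have := hs0 s
      positivity
  have hcross := fun (j k : Fin 3) (hjk : j ≠ k) => integral_cross_term hjk hmc hdm hwc hφ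
  have iS : Integrable fun x => m x * ∑ k, ‖D k x‖ ^ 2 :=
    hφ.integrable_of_eq_zero (by fun_prop) fun x hx => by simp [hD0 _ x hx]
  have iC : ∀ j k : Fin 3, Integrable fun x => m x * (2 * (inner ℂ (D j x) (sigmaMul j k (D k x))).re) :=
    fun j k => hφ.integrable_of_eq_zero (by fun_prop) fun x hx => by simp [hD0 _ x hx]
  have iA : ∀ j k : Fin 3, Integrable fun x => w x * ‖angularDeriv j k φ x‖ ^ 2 := fun j k =>
    hφ.integrable_of_eq_zero (by have := hΛ j k; fun_prop) fun x hx => by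
      simp [angularDeriv, hφ.fderiv_eq_zero hx]
  have iB : ∀ j k : Fin 3, Integrable fun x => w x *
      (inner ℂ (φ x) (sigmaMul j k (angularDeriv j k φ x))).re := fun j k =>
    hφ.integrable_of_eq_zero (by have := hΛ j k; fun_prop) fun x hx => by simp [hφ.eq_zero hx]
  have hpair : ∀ j k : Fin 3, j ≠ k →
      -∫ x, w x * ‖angularDeriv j k φ x‖ ^ 2 ≤
        ∫ x, m x * (2 * (inner ℂ (D j x) (sigmaMul j k (D k x))).re) := fun j k hjk => by
    have h1 := hang j k hjk
    simp only [mul_sub] at h1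
    rw [integral_sub (iA j k) (iB j k)] at h1
    rw [hcross j k hjk]
    linarith
  have hsplit : ∫ x, m x * ‖sigmaGrad φ x‖ ^ 2 = (∫ x, m x * ∑ k, ‖D k x‖ ^ 2) +
      (∫ x, m x * (2 * (inner ℂ (D 0 x) (sigmaMul 0 1 (D 1 x))).re)) +
      (∫ x, m x * (2 * (inner ℂ (D 0 x) (sigmaMul 0 2 (D 2 x))).re)) +
      ∫ x, m x * (2 * (inner ℂ (D 1 x) (sigmaMul 1 2 (D 2 x))).re) := by
    rw [← integral_add_four iS (iC 0 1) (iC 0 2) (iC 1 2)]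
    refine integral_congr_ae (Eventually.of_forall fun x => ?_)
    simp only [sigmaGrad_eq]
    rw [norm_sq_sum_sigma fun k => fderiv ℝ φ x (EuclideanSpace.single k 1)]
    ring
  have hd0 : Continuous fun x => fderiv ℝ φ x x :=
    (hφ.1.continuous_fderiv (by simp)).clm_apply continuous_id
  have hm0 : ∀ x, m x ≠ 0 := fun x => (div_pos (hrp x) (hq x)).ne'
  have hr3 : ∀ x, softNorm ε x ^ 3 ≠ 0 := fun x => pow_ne_zero _ (hr0 x)
  have iR : Integrable fun x => 2 / softNorm ε x * (inner ℂ (φ x) (fderiv ℝ φ x x)).re :=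
    hφ.integrable_of_eq_zero (by fun_prop (disch := assumption)) fun x hx => by
      simp [hφ.eq_zero hx]
  have iM : Integrable fun x => ‖φ x‖ ^ 2 / m x :=
    hφ.integrable_of_eq_zero (by fun_prop (disch := assumption)) fun x hx => by
      simp [hφ.eq_zero hx]
  have iT : Integrable fun x => (3 / softNorm ε x - ‖x‖ ^ 2 / softNorm ε x ^ 3) * ‖φ x‖ ^ 2 :=
    hφ.integrable_of_eq_zero (by fun_prop (disch := assumption)) fun x hx => by
      simp [hφ.eq_zero hx]
  -- The cross terms have been traded for -w times the squared angular derivatives; Lagrange's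
  -- identity turns the integrand on the right into (m - w|x|²)|∇φ|² + w|x·∇φ|².
  have hlow : ∫ x, (-(2 / softNorm ε x * (inner ℂ (φ x) (fderiv ℝ φ x x)).re) - ‖φ x‖ ^ 2 / m x) ≤
      ∫ x, (m x * ∑ k, ‖D k x‖ ^ 2 - w x * ‖angularDeriv 0 1 φ x‖ ^ 2 -
        w x * ‖angularDeriv 0 2 φ x‖ ^ 2 - w x * ‖angularDeriv 1 2 φ x‖ ^ 2) := by
    refine integral_mono (iR.neg.sub iM) (((iS.sub (iA 0 1)).sub (iA 0 2)).sub (iA 1 2))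
      fun x => ?_
    have hs := softNorm_sq ε x
    have hid := norm_sq_mul_sum_norm_sq x fun k => D k x
    have hfs : fderiv ℝ φ x x = ∑ k, x k • D k x := fderiv_self_eq_sum φ x
    have hr := hrp x
    have hqx := hq x
    have hwx : 0 < w x := by simp only [hw]; positivity
    have hmx : 0 < m x := by simp only [hm]; positivity
    have h := hardy_pointwise (r := softNorm ε x) (s := ‖x‖ ^ 2) (a := ∑ k, ‖D k x‖ ^ 2)
      (b := ‖fderiv ℝ φ x x‖ ^ 2) (c := ‖φ x‖ ^ 2) (p := (inner ℂ (φ x) (fderiv ℝ φ x x)).re)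
      (M := m x) (w := w x) hr hmx (by nlinarith) hwx.le ?_ ?_ (by positivity)
      (by positivity) ?_ (by positivity)
    · refine h.trans (le_of_eq ?_)
      change _ = _ - w x * ‖x 0 • D 1 x - x 1 • D 0 x‖ ^ 2 - w x * ‖x 0 • D 2 x - x 2 • D 0 x‖ ^ 2
        - w x * ‖x 1 • D 2 x - x 2 • D 1 x‖ ^ 2
      rw [hfs]
      linear_combination -(w x) * hid
    · have : w x * softNorm ε x ^ 2 ≤ m x := by
        simp only [hw, hm]
        rw [one_div, inv_mul_le_iff₀ (by positivity), mul_div_assoc', le_div_iff₀ hqx]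
        have : 1 ≤ 1 + α * softNorm ε x := by nlinarith
        calc softNorm ε x ^ 2 * (1 + α * softNorm ε x)
            ≤ softNorm ε x ^ 2 * (1 + α * softNorm ε x) ^ 2 := by
              gcongr
              exact le_self_pow₀ this two_ne_zero
          _ = _ := by ring
      refine le_trans ?_ this
      gcongr
      nlinarith
    · rw [hid, ← hfs]
      have h1 := sq_nonneg ‖x 0 • D 1 x - x 1 • D 0 x‖
      have h2 := sq_nonneg ‖x 0 • D 2 x - x 2 • D 0 x‖
      have h3 := sq_nonneg ‖x 1 • D 2 x - x 2 • D 1 x‖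
      linarith
    · rw [← sq_abs, ← mul_pow]
      gcongr
      rw [mul_comm]
      exact (Complex.abs_re_le_norm _).trans (norm_inner_le_norm _ _)
  rw [hsplit]
  have h01 := hpair 0 1 (by decide)
  have h02 := hpair 0 2 (by decide)
  have h12 := hpair 1 2 (by decide)
  have iRn : Integrable fun x => -(2 / softNorm ε x * (inner ℂ (φ x) (fderiv ℝ φ x x)).re) := iR.neg
  rw [integral_sub_four iS (iA 0 1) (iA 0 2) (iA 1 2),
    integral_sub iRn iM, integral_neg, integral_radial_term hε hφ, neg_neg,
    ← integral_sub iT iM] at hlow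
  -- With |x| ≤ r the divergence 3/r - |x|²/r³ is at least 2/r, and subtracting 1/m = 1/r + α leaves
  -- 1/r - α.
  have hfin : ∫ x, (1 / softNorm ε x - α) * ‖φ x‖ ^ 2 ≤
      ∫ x, ((3 / softNorm ε x - ‖x‖ ^ 2 / softNorm ε x ^ 3) * ‖φ x‖ ^ 2 - ‖φ x‖ ^ 2 / m x) := by
    refine integral_mono ?_ (iT.sub iM) fun x => ?_
    · refine hφ.integrable_of_eq_zero (by fun_prop (disch := assumption)) fun x hx => by
        simp [hφ.eq_zero hx]
    · have hr := hrp x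
      have hqx := hq x
      have h1 : ‖x‖ ^ 2 / softNorm ε x ^ 3 ≤ 1 / softNorm ε x := by
        rw [div_le_div_iff₀ (by positivity) hr, one_mul, pow_succ _ 2, softNorm_sq]
        gcongr
        nlinarith
      have h2 : ‖φ x‖ ^ 2 / m x = (1 / softNorm ε x + α) * ‖φ x‖ ^ 2 := by
        simp only [hm]
        field_simp
      simp only
      rw [h2, ← sub_mul]
      refine mul_le_mul_of_nonneg_right ?_ (sq_nonneg _)
      have : 3 / softNorm ε x = 1 / softNorm ε x + 1 / softNorm ε x + 1 / softNorm ε x := by ring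
      linarith
  linarith

/-! ### Removing the regularization -/

theorem ae_ne_zero_space : ∀ᵐ x : Space, x ≠ 0 := by
  rw [ae_iff]
  simp

theorem locallyIntegrable_inv_norm : LocallyIntegrable fun x : Space => ‖x‖⁻¹ := by
  refine locallyIntegrable_of_norm_le_rpow (C := 1) (α := 1) (by simp) (by simp) ?_ (by fun_prop)
  exact Eventually.of_forall fun x => by simp [Real.rpow_neg_one]

theorem IsTestSpinor.integrable_norm_sq {φ : Space → Spinor} (hφ : IsTestSpinor φ) :
    Integrable fun x => ‖φ x‖ ^ 2 := by
  have hφc : Continuous φ := hφ.1.continuous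
  exact hφ.integrable_of_eq_zero (by fun_prop) fun x hx => by simp [hφ.eq_zero hx]

theorem IsTestSpinor.integrable_norm_sq_sigmaGrad {φ : Space → Spinor} (hφ : IsTestSpinor φ) :
    Integrable fun x => ‖sigmaGrad φ x‖ ^ 2 := by
  have hσ := hφ.continuous_sigmaGrad
  exact hφ.integrable_of_eq_zero (by fun_prop) fun x hx => by simp [hφ.sigmaGrad_eq_zero hx]

theorem IsTestSpinor.integrable_inv_norm {φ : Space → Spinor} (hφ : IsTestSpinor φ) :
    Integrable fun x => ‖x‖⁻¹ * ‖φ x‖ ^ 2 := by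
  have hφc : Continuous φ := hφ.1.continuous
  have h := locallyIntegrable_inv_norm.integrable_smul_left_of_hasCompactSupport
    (g := fun x => ‖φ x‖ ^ 2) (by fun_prop)
    (HasCompactSupport.intro hφ.2 fun x hx => by simp [hφ.eq_zero hx])
  simpa [mul_comm] using h

theorem tendsto_softNorm (x : Space) :
    Tendsto (fun n : ℕ => softNorm (1 / ((n : ℝ) + 1)) x) atTop (𝓝 ‖x‖) := by
  have h : Tendsto (fun n : ℕ => √(‖x‖ ^ 2 + (1 / ((n : ℝ) + 1)) ^ 2)) atTop
      (𝓝 √(‖x‖ ^ 2 + 0 ^ 2)) :=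
    ((tendsto_const_nhds.add (tendsto_one_div_add_atTop_nhds_zero_nat.pow 2))).sqrt
  simpa [softNorm] using h

theorem norm_le_softNorm (ε : ℝ) (x : Space) : ‖x‖ ≤ softNorm ε x :=
  Real.le_sqrt_of_sq_le (by nlinarith [sq_nonneg ε])

/-- The Hardy-Dirac inequality for the Coulomb potential. -/
theorem hardy_dirac {α : ℝ} (hα : 0 < α) {φ : Space → Spinor} (hφ : IsTestSpinor φ) :
    (∫ x, ‖x‖⁻¹ * ‖φ x‖ ^ 2) - α * ∫ x, ‖φ x‖ ^ 2 ≤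
      ∫ x, ‖x‖ / (1 + α * ‖x‖) * ‖sigmaGrad φ x‖ ^ 2 := by
  have hε : ∀ n : ℕ, (0 : ℝ) < 1 / ((n : ℝ) + 1) := fun n => by positivity
  have hφc : Continuous φ := hφ.1.continuous
  have hσ := hφ.continuous_sigmaGrad
  have hL : Tendsto (fun n : ℕ => ∫ x, (1 / softNorm (1 / ((n : ℝ) + 1)) x - α) * ‖φ x‖ ^ 2) atTop
      (𝓝 (∫ x, (‖x‖⁻¹ - α) * ‖φ x‖ ^ 2)) := by
    refine tendsto_integral_of_dominated_convergence
      (fun x => ‖x‖⁻¹ * ‖φ x‖ ^ 2 + α * ‖φ x‖ ^ 2) (fun n => ?_)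
      (hφ.integrable_inv_norm.add (hφ.integrable_norm_sq.const_mul α)) (fun n => ?_) ?_
    · have h1 := (contDiff_softNorm (hε n)).continuous
      have h2 := fun x => (softNorm_pos (hε n) x).ne'
      exact Continuous.aestronglyMeasurable (by fun_prop (disch := assumption))
    · filter_upwards [ae_ne_zero_space] with x hx
      have hx' := norm_pos_iff.2 hx
      have h0 := softNorm_pos (hε n) x
      have h1 : 1 / softNorm (1 / ((n : ℝ) + 1)) x ≤ ‖x‖⁻¹ := by
        rw [one_div]
        exact inv_anti₀ hx' (norm_le_softNorm _ x)
      rw [norm_mul, Real.norm_of_nonneg (sq_nonneg ‖φ x‖), ← add_mul]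
      gcongr
      refine (norm_sub_le _ _).trans ?_
      rw [Real.norm_of_nonneg hα.le, Real.norm_of_nonneg (by positivity)]
      gcongr
    · filter_upwards [ae_ne_zero_space] with x hx
      have hx' := norm_ne_zero_iff.2 hx
      simp only [one_div (softNorm _ x)]
      exact (((tendsto_softNorm x).inv₀ hx').sub_const α).mul_const _
  -- Positivity of α supplies the dominating function: r/(1 + αr) ≤ 1/α for every ε.
  have hR : Tendsto (fun n : ℕ => ∫ x, softNorm (1 / ((n : ℝ) + 1)) x /
        (1 + α * softNorm (1 / ((n : ℝ) + 1)) x) * ‖sigmaGrad φ x‖ ^ 2) atTop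
      (𝓝 (∫ x, ‖x‖ / (1 + α * ‖x‖) * ‖sigmaGrad φ x‖ ^ 2)) := by
    refine tendsto_integral_of_dominated_convergence
      (fun x => 1 / α * ‖sigmaGrad φ x‖ ^ 2) (fun n => ?_)
      (hφ.integrable_norm_sq_sigmaGrad.const_mul _) (fun n => ?_) ?_
    · have h1 := (contDiff_softNorm (hε n)).continuous
      have h2 : ∀ x, 1 + α * softNorm (1 / ((n : ℝ) + 1)) x ≠ 0 := fun x => by
        have := softNorm_pos (hε n) x
        positivity
      exact Continuous.aestronglyMeasurable (by fun_prop (disch := assumption))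
    · refine Eventually.of_forall fun x => ?_
      have h0 := softNorm_pos (hε n) x
      rw [Real.norm_of_nonneg (by positivity)]
      refine mul_le_mul_of_nonneg_right ?_ (sq_nonneg _)
      rw [div_le_div_iff₀ (by positivity) hα]
      linarith
    · refine Eventually.of_forall fun x => ?_
      have h0 : 1 + α * ‖x‖ ≠ 0 := by positivity
      exact ((tendsto_softNorm x).div ((tendsto_softNorm x).const_mul α |>.const_add 1) h0).mul_const _
  have h := le_of_tendsto_of_tendsto' hL hR fun n => hardy_dirac_softNorm (hε n) hα hφ
  simp only [sub_mul] at h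
  rwa [integral_sub hφ.integrable_inv_norm (hφ.integrable_norm_sq.const_mul α),
    integral_const_mul] at h

/-! ### Lower bounds for the Dirac forms -/

/-- A lower bound for the quadratic forms of potentials dominated by a Coulomb potential. -/
theorem dirac_form_lower_bound {V : Space → ℝ} (hV : AEMeasurable V) {ν g d β : ℝ} (b : ℝ)
    (hν : 0 < ν) (hVν : ∀ x : Space, x ≠ 0 → ‖x‖ * |V x| ≤ ν) (hd : 0 < d)
    (hgd : ∀ x, d ≤ g - V x) (hβ : 0 < β) (hgβ : g ≤ β) {φ : Space → Spinor}
    (hφ : IsTestSpinor φ) :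
    Integrable (fun x => ‖sigmaGrad φ x‖ ^ 2 / (g - V x) + (b + V x) * ‖φ x‖ ^ 2) ∧
    (ν⁻¹ - ν) * (∫ x, ‖x‖⁻¹ * ‖φ x‖ ^ 2) + (b - β / ν ^ 2) * ∫ x, ‖φ x‖ ^ 2 ≤
      ∫ x, (‖sigmaGrad φ x‖ ^ 2 / (g - V x) + (b + V x) * ‖φ x‖ ^ 2) := by
  have hφc : Continuous φ := hφ.1.continuous
  have hσ := hφ.continuous_sigmaGrad
  have hVabs : ∀ x : Space, x ≠ 0 → |V x| ≤ ν * ‖x‖⁻¹ := fun x hx => by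
    rw [← div_eq_mul_inv, le_div_iff₀ (norm_pos_iff.2 hx), mul_comm]
    exact hVν x hx
  have i1 : Integrable fun x => ‖sigmaGrad φ x‖ ^ 2 / (g - V x) := by
    refine Integrable.mono' (hφ.integrable_norm_sq_sigmaGrad.const_mul d⁻¹) ?_
      (Eventually.of_forall fun x => ?_)
    · exact ((hσ.norm.pow 2).aemeasurable.div (aemeasurable_const.sub hV)).aestronglyMeasurable
    · have := hgd x
      rw [Real.norm_of_nonneg (div_nonneg (sq_nonneg _) (hd.le.trans this)), div_eq_inv_mul]
      gcongr
  have i2 : Integrable fun x => V x * ‖φ x‖ ^ 2 := by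
    refine Integrable.mono' (hφ.integrable_inv_norm.const_mul ν) ?_ ?_
    · exact (hV.mul (hφc.norm.pow 2).aemeasurable).aestronglyMeasurable
    · filter_upwards [ae_ne_zero_space] with x hx
      rw [norm_mul, Real.norm_of_nonneg (sq_nonneg ‖φ x‖), ← mul_assoc]
      gcongr
      exact hVabs x hx
  have i3 := hφ.integrable_inv_norm
  have i4 := hφ.integrable_norm_sq
  have i5 : Integrable fun x => (b + V x) * ‖φ x‖ ^ 2 := by
    simp only [add_mul]
    exact (i4.const_mul b).add i2
  refine ⟨i1.add i5, ?_⟩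
  rw [integral_add i1 i5]
  have h1 : ∫ x, (b * ‖φ x‖ ^ 2 - ν * (‖x‖⁻¹ * ‖φ x‖ ^ 2)) ≤ ∫ x, (b + V x) * ‖φ x‖ ^ 2 := by
    refine integral_mono_ae ((i4.const_mul b).sub (i3.const_mul ν)) i5 ?_
    filter_upwards [ae_ne_zero_space] with x hx
    have := neg_le_of_abs_le (hVabs x hx)
    rw [← mul_assoc, ← sub_mul]
    refine mul_le_mul_of_nonneg_right ?_ (sq_nonneg _)
    linarith
  rw [integral_sub (i4.const_mul b) (i3.const_mul ν), integral_const_mul, integral_const_mul] at h1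
  -- From g - V ≤ β + ν/|x| one gets 1/(g - V) ≥ ν⁻¹|x|/(1 + (β/ν)|x|), which dictates α = β/ν.
  have h2 := hardy_dirac (α := β / ν) (by positivity) hφ
  have h3 : ν⁻¹ * ∫ x, ‖x‖ / (1 + β / ν * ‖x‖) * ‖sigmaGrad φ x‖ ^ 2 ≤
      ∫ x, ‖sigmaGrad φ x‖ ^ 2 / (g - V x) := by
    rw [← integral_const_mul]
    refine integral_mono_of_nonneg (Eventually.of_forall fun x => by positivity) i1 ?_
    filter_upwards [ae_ne_zero_space] with x hx
    have hx' := norm_pos_iff.2 hx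
    have hpos := hd.trans_le (hgd x)
    have h4 : g - V x ≤ β + ν * ‖x‖⁻¹ := by
      have := neg_le_of_abs_le (hVabs x hx)
      linarith
    have h5 : ν⁻¹ * (‖x‖ / (1 + β / ν * ‖x‖)) = (β + ν * ‖x‖⁻¹)⁻¹ := by
      have : 0 < β * ‖x‖ + ν := by positivity
      field_simp
      ring
    rw [← mul_assoc, h5, div_eq_inv_mul]
    gcongr
  have h6 : ν⁻¹ * ((∫ x, ‖x‖⁻¹ * ‖φ x‖ ^ 2) - β / ν * ∫ x, ‖φ x‖ ^ 2) ≤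
      ∫ x, ‖sigmaGrad φ x‖ ^ 2 / (g - V x) := 
    (mul_le_mul_of_nonneg_left h2 (by positivity)).trans h3
  have h7 : ν⁻¹ * ((∫ x, ‖x‖⁻¹ * ‖φ x‖ ^ 2) - β / ν * ∫ x, ‖φ x‖ ^ 2) =
      ν⁻¹ * (∫ x, ‖x‖⁻¹ * ‖φ x‖ ^ 2) - β / ν ^ 2 * ∫ x, ‖φ x‖ ^ 2 := by
    field_simp
  linarith

/-- With 1 + c = ν², take β = ν² in `dirac_form_lower_bound`: the coefficient of ‖φ‖² becomes (1 -
c) - 1 = 1 - ν² > 0, and that of ∫|φ|²/|x| is ν⁻¹ - ν > 0. Since V ≤ 0, also sup V < ν² = 1 + c. -/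
theorem hardyDiracAssumption_of_coulomb_bound {V : Space → ℝ} (hV : AEMeasurable V) (hV0 : ∀ x, V x ≤ 0)
    {ν : ℝ} (hν : 0 < ν) (hν1 : ν < 1) (hVν : ∀ x : Space, x ≠ 0 → ‖x‖ * |V x| ≤ ν) :
    HardyDiracAssumption V (ν ^ 2 - 1) := by
  have hν2 : 0 < ν ^ 2 := by positivity
  have hν3 : ν ^ 2 < 1 := by nlinarith
  have key := fun (φ : Space → Spinor) (hφ : IsTestSpinor φ) =>
    dirac_form_lower_bound (g := 1 + (ν ^ 2 - 1)) (d := ν ^ 2) (β := ν ^ 2) hV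
      (1 - (ν ^ 2 - 1)) hν hVν hν2 (fun x => by linarith [hV0 x]) hν2 (by linarith) hφ
  refine ⟨by linarith, by linarith, ⟨0, ?_⟩, ?_, fun φ hφ => (key φ hφ).1, fun φ hφ => ?_⟩
  · rintro _ ⟨x, rfl⟩
    exact hV0 x
  · have : ⨆ x, V x ≤ 0 := ciSup_le hV0
    linarith
  · refine le_trans ?_ (key φ hφ).2
    rw [div_self hν2.ne']
    have h1 : 0 ≤ ν⁻¹ - ν := by
      have := one_le_inv_iff₀.2 ⟨hν, hν1.le⟩
      linarith
    have h2 : (0 : ℝ) ≤ ∫ x, ‖x‖⁻¹ * ‖φ x‖ ^ 2 := integral_nonneg fun x => by positivity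
    have h3 : (0 : ℝ) ≤ ∫ x, ‖φ x‖ ^ 2 := integral_nonneg fun x => by positivity
    have h4 : 0 ≤ 1 - (ν ^ 2 - 1) - 1 := by linarith
    positivity

/-! ### Upper components: the form domain -/

theorem eLpNorm_two_eq {f : Space → Spinor} (hf : MemLp f 2) :
    eLpNorm f 2 = ENNReal.ofReal √(∫ x, ‖f x‖ ^ 2) := by
  rw [hf.eLpNorm_eq_integral_rpow_norm two_ne_zero ENNReal.ofNat_ne_top, Real.sqrt_eq_rpow]
  simp

/-- Fatou's lemma; it passes each uniform weighted bound on approximants to the limit. -/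
theorem memLp_two_of_ae_tendsto {f : ℕ → Space → Spinor} {g : Space → Spinor}
    (hf : ∀ n, MemLp (f n) 2) (hlim : ∀ᵐ x, Tendsto (fun n => f n x) atTop (𝓝 (g x))) {K : ℝ}
    (hK : ∀ n, ∫ x, ‖f n x‖ ^ 2 ≤ K) : MemLp g 2 := by
  have hfm := fun n => (hf n).aestronglyMeasurable
  refine ⟨aestronglyMeasurable_of_tendsto_ae _ hfm hlim, ?_⟩
  refine (Lp.eLpNorm_lim_le_liminf_eLpNorm hfm g hlim).trans_lt ?_
  refine lt_of_le_of_lt ?_ (ENNReal.ofReal_lt_top (r := √K))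
  refine Filter.liminf_le_of_frequently_le' (Frequently.of_forall fun n => ?_)
  rw [eLpNorm_two_eq (hf n)]
  exact ENNReal.ofReal_le_ofReal (Real.sqrt_le_sqrt (hK n))

theorem norm_sq_rpow_smul (x : Space) (a : Spinor) :
    ‖‖x‖ ^ (-(1 / 2) : ℝ) • a‖ ^ 2 = ‖x‖⁻¹ * ‖a‖ ^ 2 := by
  rw [norm_smul, mul_pow, Real.norm_of_nonneg (by positivity), ← Real.rpow_mul_natCast (norm_nonneg x)]
  norm_num [Real.rpow_neg_one]

theorem measurable_rpow_norm : Measurable fun x : Space => ‖x‖ ^ (-(1 / 2) : ℝ) := by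
  fun_prop

theorem IsTestSpinor.memLp_rpow_smul {u : Space → Spinor} (hu : IsTestSpinor u) :
    MemLp (fun x => ‖x‖ ^ (-(1 / 2) : ℝ) • u x) 2 := by
  have hm : AEStronglyMeasurable (fun x => ‖x‖ ^ (-(1 / 2) : ℝ) • u x) volume :=
    measurable_rpow_norm.aestronglyMeasurable.smul hu.1.continuous.aestronglyMeasurable
  rw [memLp_two_iff_integrable_sq_norm hm]
  simp only [norm_sq_rpow_smul]
  exact hu.integrable_inv_norm

theorem IsTestSpinor.sub {u v : Space → Spinor} (hu : IsTestSpinor u) (hv : IsTestSpinor v) :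
    IsTestSpinor (u - v) :=
  ⟨hu.1.sub hv.1, hu.2.sub hv.2⟩

theorem IsTestSpinor.memLp {u : Space → Spinor} (hu : IsTestSpinor u) : MemLp u 2 :=
  hu.1.continuous.memLp_of_hasCompactSupport hu.2

/-- The form domain is contained in the domain of `|x|^{-1/2}`. -/
theorem memLp_rpow_smul_of_mem_formDomain {V : Space → ℝ} (hV : AEMeasurable V) {ν γ d : ℝ}
    (hν : 0 < ν) (hν1 : ν < 1) (hVν : ∀ x : Space, x ≠ 0 → ‖x‖ * |V x| ≤ ν) (hd : 0 < d)
    (hγ : ∀ x, d ≤ γ - V x) {φ : L2Spinor} (hφ : φ ∈ formDomain V γ) :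
    MemLp (fun x : Space => ‖x‖ ^ (-(1 / 2) : ℝ) • φ x) 2 := by
  obtain ⟨u, hu, hconv, hcauchy⟩ := hφ
  have hc1 : 0 < ν⁻¹ - ν := by
    have := (one_lt_inv₀ hν).2 hν1
    linarith
  -- β = |γ| + 1 is positive and at least γ, as the lower bound requires; C then absorbs the L²
  -- coefficient whatever its sign.
  set C := |(2 - γ) - (|γ| + 1) / ν ^ 2| with hC
  have key : ∀ v, IsTestSpinor v →
      (ν⁻¹ - ν) * (∫ x, ‖x‖⁻¹ * ‖v x‖ ^ 2) ≤ bForm V γ v + C * ∫ x, ‖v x‖ ^ 2 := fun v hv => by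
    have h := (dirac_form_lower_bound hV (2 - γ) hν hVν hd hγ (β := |γ| + 1) (by positivity)
      (by linarith [le_abs_self γ]) hv).2
    have h2 : 0 ≤ ∫ x, ‖v x‖ ^ 2 := integral_nonneg fun x => by positivity
    have h3 := mul_le_mul_of_nonneg_right (neg_abs_le ((2 - γ) - (|γ| + 1) / ν ^ 2)) h2
    rw [← hC] at h3
    unfold bForm
    linarith
  have hev1 : ∀ᶠ n in atTop, eLpNorm (fun x => u n x - φ x) 2 volume < 1 :=
    hconv.eventually (gt_mem_nhds one_pos)
  have hev2 : ∀ᶠ p : ℕ × ℕ in atTop, bForm V γ (u p.1 - u p.2) < 1 :=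
    hcauchy.eventually (gt_mem_nhds one_pos)
  obtain ⟨N1, hN1⟩ := eventually_atTop.1 hev1
  obtain ⟨N2, hN2⟩ := eventually_atTop.1 hev2
  set N := max N1 (max N2.1 N2.2) with hN
  -- The form values and L² norms of uₙ - u_N need only stay bounded: a form value below 1 and an L²
  -- norm of at most 2 give the constant 1 + 4C.
  have hbound : ∀ n, N ≤ n → (∫ x, ‖x‖⁻¹ * ‖(u n - u N) x‖ ^ 2) ≤ (1 + C * 4) / (ν⁻¹ - ν) := by
    intro n hn
    have hb : bForm V γ (u n - u N) < 1 := hN2 (n, N) (by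
      constructor <;> simp only <;> omega)
    have ht := (hu n).sub (hu N)
    have hL : eLpNorm (u n - u N) 2 volume ≤ ENNReal.ofReal 2 := by
      have e : u n - u N = (fun x => u n x - φ x) - fun x => u N x - φ x := by
        ext1 x
        simp
      have m := fun k => (((hu k).memLp.sub (Lp.memLp φ)).aestronglyMeasurable :
        AEStronglyMeasurable (fun x => u k x - φ x) volume)
      rw [e]
      refine (eLpNorm_sub_le (m n) (m N) one_le_two).trans ?_
      exact (add_le_add (hN1 n (by omega)).le (hN1 N (by omega)).le).trans_eq (by norm_num)
    rw [eLpNorm_two_eq ht.memLp, ENNReal.ofReal_le_ofReal_iff zero_le_two, Real.sqrt_le_left zero_le_two] at hL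
    rw [le_div_iff₀' hc1]
    refine (key _ ht).trans ?_
    have : C * ∫ x, ‖(u n - u N) x‖ ^ 2 ≤ C * 4 := by
      refine mul_le_mul_of_nonneg_left (by linarith) (abs_nonneg _)
    linarith
  have hmeas : TendstoInMeasure volume u atTop φ :=
    tendstoInMeasure_of_tendsto_eLpNorm two_ne_zero (fun n => (hu n).memLp.aestronglyMeasurable)
      (Lp.aestronglyMeasurable φ) hconv
  obtain ⟨ns, hns, hae⟩ := hmeas.exists_seq_tendsto_ae
  have hsub : MemLp (fun x : Space => ‖x‖ ^ (-(1 / 2) : ℝ) • (φ x - u N x)) 2 := by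
    refine memLp_two_of_ae_tendsto
      (f := fun k x => ‖x‖ ^ (-(1 / 2) : ℝ) • (u (ns (k + N)) - u N) x)
      (fun k => ((hu _).sub (hu N)).memLp_rpow_smul) ?_ (K := (1 + C * 4) / (ν⁻¹ - ν)) fun k => ?_
    · filter_upwards [hae] with x hx
      exact ((hx.comp (tendsto_add_atTop_nat N)).sub_const _).const_smul _
    · simp only [norm_sq_rpow_smul]
      exact hbound _ ((Nat.le_add_left N k).trans (hns.id_le _))
  convert hsub.add (hu N).memLp_rpow_smul using 1
  ext1 x
  simp [← smul_add]

/-! ### Mollification in weighted L² spaces -/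

/-- The convolution `(k * h)(x) = ∫ k(x - t) h(t) dt`. -/
noncomputable def mollify (k : Space → ℝ) (h : Space → Spinor) (x : Space) : Spinor :=
  ∫ t, k (x - t) • h t

theorem mollify_eq_convolution (k : Space → ℝ) (h : Space → Spinor) :
    mollify k h = convolution k h (ContinuousLinearMap.lsmul ℝ ℝ) volume := by
  ext1 x
  rw [convolution_eq_swap]
  rfl

theorem lintegral_ofReal_sub_left {k : Space → ℝ} (hk0 : ∀ x, 0 ≤ k x) (hki : Integrable k)
    (hk1 : ∫ x, k x = 1) (x : Space) : ∫⁻ t, ENNReal.ofReal (k (x - t)) = 1 := by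
  rw [← ofReal_integral_eq_lintegral_ofReal (hki.comp_sub_left x)
    (Eventually.of_forall fun t => hk0 _), integral_sub_left_eq_self k volume x, hk1,
    ENNReal.ofReal_one]

theorem lintegral_ofReal_sub_right {k : Space → ℝ} (hk0 : ∀ x, 0 ≤ k x) (hki : Integrable k)
    (hk1 : ∫ x, k x = 1) (t : Space) : ∫⁻ x, ENNReal.ofReal (k (x - t)) = 1 := by
  rw [← ofReal_integral_eq_lintegral_ofReal (hki.comp_sub_right t)
    (Eventually.of_forall fun t => hk0 _), integral_sub_right_eq_self k t, hk1,
    ENNReal.ofReal_one]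

/-- The Cauchy-Schwarz inequality for convolutions with a weight. -/
theorem enorm_mollify_sq_le {k w : Space → ℝ} {h : Space → Spinor} (hk : Continuous k)
    (hk0 : ∀ x, 0 ≤ k x) (hw : Measurable w) (hw0 : ∀ x, 0 < w x)
    (hh : AEStronglyMeasurable h) (x : Space) :
    ‖mollify k h x‖ₑ ^ 2 ≤
      (∫⁻ t, ENNReal.ofReal (k (x - t)) * (ENNReal.ofReal (w t) * ‖h t‖ₑ ^ 2)) *
      ∫⁻ t, ENNReal.ofReal (k (x - t) * (w t)⁻¹) := by
  -- Split k|h| as √(kw)|h| · √(k/w) and apply Cauchy-Schwarz.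
  set f : Space → ENNReal := fun t => ENNReal.ofReal √(k (x - t) * w t) * ‖h t‖ₑ with hf
  set g : Space → ENNReal := fun t => ENNReal.ofReal √(k (x - t) * (w t)⁻¹) with hg
  have hkm : Measurable fun t => k (x - t) := (hk.comp (continuous_const.sub continuous_id)).measurable
  have hfm : AEMeasurable f := by
    refine AEMeasurable.mul ?_ hh.enorm
    exact (ENNReal.measurable_ofReal.comp (hkm.mul hw).sqrt).aemeasurable
  have hgm : AEMeasurable g :=
    (ENNReal.measurable_ofReal.comp (hkm.mul hw.inv).sqrt).aemeasurable
  have h1 : ‖mollify k h x‖ₑ ≤ ∫⁻ t, (f * g) t := by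
    refine (enorm_integral_le_lintegral_enorm _).trans (le_of_eq (lintegral_congr fun t => ?_))
    have hk' := hk0 (x - t)
    have hw' := hw0 t
    rw [enorm_smul, Pi.mul_apply]
    simp only [hf, hg]
    rw [mul_right_comm, ← ENNReal.ofReal_mul (Real.sqrt_nonneg _), ← Real.sqrt_mul (by positivity),
      Real.enorm_eq_ofReal hk']
    congr 2
    rw [show k (x - t) * w t * (k (x - t) * (w t)⁻¹) = k (x - t) ^ 2 by field_simp,
      Real.sqrt_sq hk']
  have h2 := ENNReal.lintegral_mul_le_Lp_mul_Lq volume Real.HolderConjugate.two_two hfm hgm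
  have h3 : ∀ t, f t ^ (2 : ℝ) =
      ENNReal.ofReal (k (x - t)) * (ENNReal.ofReal (w t) * ‖h t‖ₑ ^ 2) := fun t => by
    have hk' := hk0 (x - t)
    have hw' := hw0 t
    rw [ENNReal.rpow_two]
    simp only [hf]
    rw [mul_pow, ← ENNReal.ofReal_pow (Real.sqrt_nonneg _), Real.sq_sqrt (by positivity),
      ENNReal.ofReal_mul hk', mul_assoc]
  have h4 : ∀ t, g t ^ (2 : ℝ) = ENNReal.ofReal (k (x - t) * (w t)⁻¹) := fun t => by
    have hk' := hk0 (x - t)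
    have hw' := hw0 t
    rw [ENNReal.rpow_two]
    simp only [hg]
    rw [← ENNReal.ofReal_pow (Real.sqrt_nonneg _), Real.sq_sqrt (by positivity)]
  simp only [h3, h4] at h2
  refine (pow_le_pow_left' (h1.trans h2) 2).trans (le_of_eq ?_)
  rw [mul_pow, ← ENNReal.rpow_two, ← ENNReal.rpow_two, ← ENNReal.rpow_mul, ← ENNReal.rpow_mul]
  norm_num

/-- Weighted `L²` bounds for convolutions. -/
theorem lintegral_mollify_le {k w : Space → ℝ} {h : Space → Spinor} {C : ℝ} (hk : Continuous k)
    (hk0 : ∀ x, 0 ≤ k x) (hki : Integrable k) (hk1 : ∫ x, k x = 1) (hw : Measurable w)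
    (hw0 : ∀ x, 0 < w x) (hh : AEStronglyMeasurable h)
    (hkw : ∀ᵐ x, ∫⁻ t, ENNReal.ofReal (k (x - t) * (w t)⁻¹) ≤ ENNReal.ofReal (C * (w x)⁻¹)) :
    ∫⁻ x, ENNReal.ofReal (w x) * ‖mollify k h x‖ₑ ^ 2 ≤
      ENNReal.ofReal C * ∫⁻ x, ENNReal.ofReal (w x) * ‖h x‖ₑ ^ 2 := by
  have hm : AEMeasurable fun t => ENNReal.ofReal (w t) * ‖h t‖ₑ ^ 2 :=
    (ENNReal.measurable_ofReal.comp hw).aemeasurable.mul (hh.enorm.pow_const 2)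
  have hkm : Measurable fun p : Space × Space => ENNReal.ofReal (k (p.1 - p.2)) :=
    ENNReal.measurable_ofReal.comp (hk.comp (continuous_fst.sub continuous_snd)).measurable
  calc ∫⁻ x, ENNReal.ofReal (w x) * ‖mollify k h x‖ₑ ^ 2
      ≤ ∫⁻ x, ENNReal.ofReal C *
        ∫⁻ t, ENNReal.ofReal (k (x - t)) * (ENNReal.ofReal (w t) * ‖h t‖ₑ ^ 2) := by
        refine lintegral_mono_ae ?_
        -- The bound k * w⁻¹ ≤ C w⁻¹ cancels the outer weight w(x). After exchanging integrals, only
        -- the total mass 1 of the kernel remains.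
        filter_upwards [hkw] with x hx
        have hwx := hw0 x
        have h1 := (enorm_mollify_sq_le hk hk0 hw hw0 hh x).trans (mul_le_mul_right hx _)
        refine (mul_le_mul_right h1 _).trans (le_of_eq ?_)
        rw [mul_left_comm, ← ENNReal.ofReal_mul hwx.le, mul_comm]
        congr 2
        field_simp
    _ = ENNReal.ofReal C * ∫⁻ t, ∫⁻ x, ENNReal.ofReal (k (x - t)) *
        (ENNReal.ofReal (w t) * ‖h t‖ₑ ^ 2) := by
        rw [lintegral_const_mul' _ _ ENNReal.ofReal_ne_top, lintegral_lintegral_swap]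
        exact hkm.aemeasurable.mul hm.comp_snd
    _ = _ := by
        congr 1
        refine lintegral_congr fun t => ?_
        rw [lintegral_mul_const _ (by fun_prop), lintegral_ofReal_sub_right hk0 hki hk1, one_mul]

theorem integral_mollify_le {k w : Space → ℝ} {h : Space → Spinor} {C : ℝ} (hC : 0 ≤ C)
    (hk : Continuous k) (hk0 : ∀ x, 0 ≤ k x) (hki : Integrable k) (hk1 : ∫ x, k x = 1)
    (hw : Measurable w) (hw0 : ∀ x, 0 < w x) (hh : AEStronglyMeasurable h)
    (hwh : Integrable fun x => w x * ‖h x‖ ^ 2) (hkh : Continuous (mollify k h))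
    (hkw : ∀ᵐ x, ∫⁻ t, ENNReal.ofReal (k (x - t) * (w t)⁻¹) ≤ ENNReal.ofReal (C * (w x)⁻¹)) :
    Integrable (fun x => w x * ‖mollify k h x‖ ^ 2) ∧
      ∫ x, w x * ‖mollify k h x‖ ^ 2 ≤ C * ∫ x, w x * ‖h x‖ ^ 2 := by
  have he : ∀ (v : Space → Spinor) x, ENNReal.ofReal (w x) * ‖v x‖ₑ ^ 2 =
      ENNReal.ofReal (w x * ‖v x‖ ^ 2) := fun v x => by
    rw [ENNReal.ofReal_mul (hw0 x).le, ENNReal.ofReal_pow (norm_nonneg _), ofReal_norm]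
  have hn : ∀ (v : Space → Spinor), 0 ≤ᵐ[volume] fun x => w x * ‖v x‖ ^ 2 := fun v =>
    Eventually.of_forall fun x => mul_nonneg (hw0 x).le (sq_nonneg _)
  have h1 := lintegral_mollify_le hk hk0 hki hk1 hw hw0 hh hkw
  simp only [he] at h1
  rw [← ofReal_integral_eq_lintegral_ofReal hwh (hn h), ← ENNReal.ofReal_mul hC] at h1
  have hi : Integrable fun x => w x * ‖mollify k h x‖ ^ 2 := by
    refine ⟨(hw.mul (hkh.norm.pow 2).measurable).aestronglyMeasurable, ?_⟩
    rw [hasFiniteIntegral_iff_ofReal (hn _)]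
    exact h1.trans_lt ENNReal.ofReal_lt_top
  refine ⟨hi, ?_⟩
  rw [← ofReal_integral_eq_lintegral_ofReal hi (hn _)] at h1
  refine (ENNReal.ofReal_le_ofReal_iff ?_).1 h1
  exact mul_nonneg hC (integral_nonneg_of_ae (hn h))

/-- Scaling: s³ from the volume and s⁻¹ from the integrand. -/
theorem setIntegral_ball_inv_norm {s : ℝ} (hs : 0 < s) :
    ∫ t in Metric.ball (0 : Space) s, ‖t‖⁻¹ =
      s ^ 2 * ∫ t in Metric.ball (0 : Space) 1, ‖t‖⁻¹ := by
  have h := Measure.setIntegral_comp_smul (volume : Measure Space) (fun t : Space => ‖t‖⁻¹)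
    (s := Metric.ball 0 1) hs.ne'
  rw [smul_unitBall hs.ne', Real.norm_of_nonneg hs.le] at h
  simp only [norm_smul, mul_inv, integral_const_mul, Real.norm_of_nonneg hs.le] at h
  rw [abs_of_nonneg (by positivity)] at h
  simp only [finrank_euclideanSpace, Fintype.card_fin, smul_eq_mul] at h
  field_simp at h ⊢
  linarith

/-- Convolution with a bump function maps `|x|⁻¹` to a function bounded by `C |x|⁻¹`. -/
theorem exists_bump_convolution_inv_norm_le : ∃ C : ℝ, 0 ≤ C ∧
    ∀ f : ContDiffBump (0 : Space), f.rOut ≤ 2 * f.rIn → ∀ x : Space, x ≠ 0 →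
      ∫ t, f.normed volume (x - t) * ‖t‖⁻¹ ≤ C * ‖x‖⁻¹ := by
  set v := volume.real (Metric.closedBall (0 : Space) 1) with hv
  have hvpos : 0 < v := ENNReal.toReal_pos
    (Metric.measure_closedBall_pos _ _ one_pos).ne' measure_closedBall_lt_top.ne
  set I := ∫ t in Metric.ball (0 : Space) 1, ‖t‖⁻¹ with hI
  have hI0 : 0 ≤ I := integral_nonneg fun t => by positivity
  -- The 2 comes from |t| ≥ |x|/2. On |t| < |x|/2 the kernel is at most 64/(v|x|³), and integrating
  -- |t|⁻¹ over that ball gives (|x|/2)² I, hence 16I/(v|x|).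
  refine ⟨2 + 16 / v * I, by positivity, fun f hf x hx => ?_⟩
  have hx' := norm_pos_iff.2 hx
  set k := f.normed volume with hk
  have hkc : Continuous k := f.continuous_normed
  have hkx : Continuous fun t => k (x - t) := hkc.comp (continuous_const.sub continuous_id)
  have hksupp : HasCompactSupport fun t => k (x - t) :=
    f.hasCompactSupport_normed.comp_homeomorph (Homeomorph.subLeft x)
  have hpt : ∀ t, k (x - t) * ‖t‖⁻¹ ≤ 2 * ‖x‖⁻¹ * k (x - t) +
      (Metric.ball (0 : Space) (‖x‖ / 2)).indicator (fun t => 64 / (v * ‖x‖ ^ 3) * ‖t‖⁻¹) t := by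
    intro t
    have hk0 : 0 ≤ k (x - t) := f.nonneg_normed _
    by_cases ht : t ∈ Metric.ball (0 : Space) (‖x‖ / 2)
    · rw [Set.indicator_of_mem ht]
      rw [mem_ball_zero_iff] at ht
      refine le_add_of_nonneg_of_le (by positivity) ?_
      refine mul_le_mul_of_nonneg_right ?_ (by positivity)
      by_cases hkt : k (x - t) = 0
      · rw [hkt]
        positivity
      · have hmem : x - t ∈ Function.support k := hkt
        rw [f.support_normed_eq, mem_ball_zero_iff] at hmem
        -- A kernel reaching from x into this ball has radius at least |x|/2. Its height is at most
        -- 2³/(v rOut³) because the ratio of its radii is at most 2.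
        have hR : ‖x‖ / 2 ≤ f.rOut := by
          have := norm_sub_norm_le x t
          linarith
        refine (f.normed_le_div_measure_closedBall_rOut volume 2 hf _).trans ?_
        rw [Measure.addHaar_real_closedBall _ _ f.rOut_pos.le]
        have hvb : volume.real (Metric.ball (0 : Space) 1) = v := by
          rw [hv, Measure.addHaar_real_closedBall _ _ zero_le_one]
          simp
        rw [hvb]
        simp only [finrank_euclideanSpace, Fintype.card_fin]
        rw [div_le_div_iff₀ (by have := f.rOut_pos; positivity) (by positivity)]
        have : (‖x‖ / 2) ^ 3 ≤ f.rOut ^ 3 := by gcongr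
        nlinarith
    · rw [Set.indicator_of_notMem ht, add_zero, mul_comm]
      refine mul_le_mul_of_nonneg_right ?_ hk0
      rw [mem_ball_zero_iff, not_lt] at ht
      rw [← div_eq_mul_inv, inv_le_comm₀ (by linarith) (by positivity), inv_div]
      exact ht
  have hball : IntegrableOn (fun t : Space => 64 / (v * ‖x‖ ^ 3) * ‖t‖⁻¹)
      (Metric.ball (0 : Space) (‖x‖ / 2)) := by
    refine Integrable.const_mul ?_ _
    exact (locallyIntegrable_inv_norm.integrableOn_isCompact
      (isCompact_closedBall (0 : Space) (‖x‖ / 2))).mono_set Metric.ball_subset_closedBall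
  have hki : Integrable fun t => k (x - t) := hkx.integrable_of_hasCompactSupport hksupp
  have hint := (hki.const_mul (2 * ‖x‖⁻¹)).add (hball.integrable_indicator measurableSet_ball)
  have hmono := integral_mono_of_nonneg
    (Eventually.of_forall fun t => mul_nonneg (f.nonneg_normed _) (by positivity)) hint
    (Eventually.of_forall hpt)
  refine hmono.trans (le_of_eq ?_)
  rw [integral_add' (hki.const_mul _) (hball.integrable_indicator measurableSet_ball),
    integral_indicator measurableSet_ball, integral_const_mul, integral_const_mul,
    integral_sub_left_eq_self k volume x, f.integral_normed, setIntegral_ball_inv_norm (by positivity),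
    ← hI]
  field_simp
  ring

theorem integrable_inner_of_locallyIntegrable {η F : Space → Spinor} (hη : Continuous η)
    (hηc : HasCompactSupport η) (hF : LocallyIntegrable F) :
    Integrable fun x => inner ℂ (η x) (F x) := by
  have h := hF.integrable_smul_left_of_hasCompactSupport (g := fun x => ‖η x‖) (by fun_prop)
    hηc.norm
  refine h.mono (hη.aestronglyMeasurable.inner hF.aestronglyMeasurable)
    (Eventually.of_forall fun x => ?_)
  rw [norm_smul, norm_norm]
  exact norm_inner_le_norm _ _

/-! ### Lower components: the weak Dirac equation -/

/-- `-i σ·∇χ = H` in the weak sense. -/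
def IsWeakDirac (χ H : Space → Spinor) : Prop :=
  ∀ η : Space → Spinor, IsTestSpinor η →
    ∫ x, inner ℂ (-Complex.I • sigmaGrad η x) (χ x) = ∫ x, inner ℂ (η x) (H x)

theorem contDiff_mollify {k : Space → ℝ} (hk : ContDiff ℝ ∞ k) (hkc : HasCompactSupport k)
    {h : Space → Spinor} (hh : LocallyIntegrable h) : ContDiff ℝ ∞ (mollify k h) := by
  rw [mollify_eq_convolution]
  exact hkc.contDiff_convolution_left _ hk hh

theorem fderiv_mollify {k : Space → ℝ} (hk : ContDiff ℝ 1 k) (hkc : HasCompactSupport k)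
    {h : Space → Spinor} (hh : LocallyIntegrable h) (x v : Space) :
    fderiv ℝ (mollify k h) x v = ∫ t, fderiv ℝ k (x - t) v • h t := by
  have h1 := hkc.hasFDerivAt_convolution_right (ContinuousLinearMap.lsmul ℝ ℝ).flip hh hk x
  rw [convolution_flip, ← mollify_eq_convolution] at h1
  rw [h1.fderiv, convolution_precompR_apply _ hh (hkc.fderiv ℝ) (hk.continuous_fderiv one_ne_zero),
    ← convolution_flip, convolution_eq_swap]
  rfl

theorem integrable_shift_smul {k : Space → ℝ} (hk : Continuous k) (hkc : HasCompactSupport k)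
    {h : Space → Spinor} (hh : LocallyIntegrable h) (x : Space) :
    Integrable fun t => k (x - t) • h t :=
  hh.integrable_smul_left_of_hasCompactSupport (hk.comp (continuous_const.sub continuous_id))
    (hkc.comp_homeomorph (Homeomorph.subLeft x))

/-- Weak derivatives commute with mollification. -/
theorem IsWeakDirac.sigmaGrad_mollify {χ H : Space → Spinor} (hχH : IsWeakDirac χ H)
    (hχ : LocallyIntegrable χ) (hH : LocallyIntegrable H) {k : Space → ℝ} (hk : ContDiff ℝ ∞ k)
    (hkc : HasCompactSupport k) (x : Space) :
    -Complex.I • sigmaGrad (mollify k χ) x = mollify k H x := by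
  refine ext_inner_left ℂ fun a => ?_
  -- Testing with the reflected kernel times a constant spinor reads off the a-component of the
  -- mollified equation at x.
  set η : Space → Spinor := fun t => k (x - t) • a with hη
  have hkx : ContDiff ℝ ∞ fun t => k (x - t) := hk.comp (contDiff_const.sub contDiff_id)
  have hηt : IsTestSpinor η :=
    ⟨hkx.smul contDiff_const,
      (hkc.comp_homeomorph (Homeomorph.subLeft x)).smul_right⟩
  have hk1 : ContDiff ℝ 1 k := hk.of_le (by exact_mod_cast le_top)
  have hdη : ∀ t v, fderiv ℝ η t v = -(fderiv ℝ k (x - t) v • a) := fun t v => by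
    have h1 : HasFDerivAt (fun t => x - t) (-ContinuousLinearMap.id ℝ Space) t :=
      (hasFDerivAt_id t).const_sub x
    have h2 := ((hk1.differentiable one_ne_zero (x - t)).hasFDerivAt.comp t h1).smul_const a
    have h3 : HasFDerivAt η _ t := h2
    rw [h3.fderiv]
    simp
  have hkd : ∀ j : Fin 3, Continuous fun y => fderiv ℝ k y (EuclideanSpace.single j 1) := fun j =>
    (hk1.continuous_fderiv one_ne_zero).clm_apply continuous_const
  have hint : ∀ j : Fin 3, Integrable fun t =>
      fderiv ℝ k (x - t) (EuclideanSpace.single j 1) • χ t := fun j =>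
    integrable_shift_smul (hkd j) (hkc.fderiv_apply ℝ _) hχ x
  have hpt : ∀ t, inner ℂ (-Complex.I • sigmaGrad η t) (χ t) = ∑ j : Fin 3,
      inner ℂ (Complex.I • sigma j a) (fderiv ℝ k (x - t) (EuclideanSpace.single j 1) • χ t) := by
    intro t
    rw [sigmaGrad_eq, Finset.smul_sum, sum_inner]
    refine Finset.sum_congr rfl fun j _ => ?_
    rw [hdη, map_neg, smul_neg, neg_smul, neg_neg, ← Complex.coe_smul, ← Complex.coe_smul, map_smul,
      inner_smul_left, inner_smul_left, inner_smul_left, inner_smul_right, Complex.conj_ofReal]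
  have hL : ∫ t, inner ℂ (-Complex.I • sigmaGrad η t) (χ t) =
      inner ℂ a (-Complex.I • sigmaGrad (mollify k χ) x) := by
    simp only [hpt]
    rw [integral_finsetSum _ fun j _ => (hint j).const_inner _, sigmaGrad_eq, Finset.smul_sum,
      inner_sum]
    refine Finset.sum_congr rfl fun j _ => ?_
    rw [integral_inner (hint j), fderiv_mollify hk1 hkc hχ, inner_smul_left, inner_sigma_left,
      inner_smul_right, Complex.conj_I]
  have hR : ∫ t, inner ℂ (η t) (H t) = inner ℂ a (mollify k H x) := by
    unfold mollify
    rw [← integral_inner (integrable_shift_smul hk.continuous hkc hH x)]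
    refine integral_congr_ae (Eventually.of_forall fun t => ?_)
    simp only [hη]
    rw [← Complex.coe_smul, ← Complex.coe_smul, inner_smul_left, inner_smul_right,
      Complex.conj_ofReal]
  rw [← hL, ← hR]
  exact hχH η hηt

/-- The weight `1 / (1 + |x|⁻¹)`. -/
noncomputable def coulombWeight (x : Space) : ℝ := (1 + ‖x‖⁻¹)⁻¹

theorem coulombWeight_pos (x : Space) : 0 < coulombWeight x := by
  unfold coulombWeight
  positivity

theorem coulombWeight_le_one (x : Space) : coulombWeight x ≤ 1 :=
  inv_le_one_of_one_le₀ (le_add_of_nonneg_right (by positivity))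

theorem measurable_coulombWeight : Measurable coulombWeight := by
  unfold coulombWeight
  fun_prop

theorem sigmaGrad_smul {ζ : Space → ℝ} {φ : Space → Spinor} (hζ : ContDiff ℝ 1 ζ)
    (hφ : ContDiff ℝ 1 φ) (x : Space) :
    sigmaGrad (fun x => ζ x • φ x) x = ζ x • sigmaGrad φ x +
      ∑ j : Fin 3, fderiv ℝ ζ x (EuclideanSpace.single j 1) • sigma j (φ x) := by
  have h := ((hζ.differentiable one_ne_zero x).hasFDerivAt.smul
    (hφ.differentiable one_ne_zero x).hasFDerivAt)
  have h' : HasFDerivAt (fun x => ζ x • φ x) _ x := h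
  rw [sigmaGrad_eq, sigmaGrad_eq, Finset.smul_sum, ← Finset.sum_add_distrib]
  refine Finset.sum_congr rfl fun j _ => ?_
  rw [h'.fderiv]
  simp [← Complex.coe_smul]

/-- Cutoffs of smooth spinors satisfy a Hardy inequality, with constants depending on the
cutoff only. -/
theorem exists_hardy_cutoff {ζ : Space → ℝ} (hζ : ContDiff ℝ ∞ ζ) (hζc : HasCompactSupport ζ)
    (hζ1 : ∀ x, |ζ x| ≤ 1) : ∃ B : ℝ, 0 ≤ B ∧ ∀ φ : Space → Spinor, ContDiff ℝ ∞ φ →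
      Integrable (fun x => ‖φ x‖ ^ 2) →
      Integrable (fun x => coulombWeight x * ‖sigmaGrad φ x‖ ^ 2) →
      ∫ x, ‖x‖⁻¹ * ‖ζ x • φ x‖ ^ 2 ≤ B * (∫ x, ‖φ x‖ ^ 2) +
        2 * ∫ x, coulombWeight x * ‖sigmaGrad φ x‖ ^ 2 := by
  have hζ' : ContDiff ℝ 1 ζ := hζ.of_le (by exact_mod_cast le_top)
  obtain ⟨b, hb⟩ := (hζc.fderiv ℝ).exists_bound_of_continuous (hζ'.continuous_fderiv one_ne_zero)
  have hb0 : 0 ≤ b := (norm_nonneg _).trans (hb 0)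
  -- The 1 is the α = 1 term of `hardy_dirac`; 2(3b)² comes from squaring the commutator with ζ,
  -- three terms each at most b|φ|.
  refine ⟨1 + 2 * (3 * b) ^ 2, by positivity, fun φ hφ h1 h2 => ?_⟩
  have hφ1 : ContDiff ℝ 1 φ := hφ.of_le (by exact_mod_cast le_top)
  have ht : IsTestSpinor fun x => ζ x • φ x := ⟨hζ.smul hφ, hζc.smul_right⟩
  have hH := hardy_dirac one_pos ht
  have hle : ∀ x, ‖ζ x • φ x‖ ^ 2 ≤ ‖φ x‖ ^ 2 := fun x => by
    rw [norm_smul, mul_pow]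
    refine mul_le_of_le_one_left (sq_nonneg _) ?_
    exact pow_le_one₀ (norm_nonneg _) (hζ1 x)
  have i1 : ∫ x, ‖ζ x • φ x‖ ^ 2 ≤ ∫ x, ‖φ x‖ ^ 2 := integral_mono ht.integrable_norm_sq h1 hle
  have hgrad : ∀ x, ‖sigmaGrad (fun x => ζ x • φ x) x‖ ≤ ‖sigmaGrad φ x‖ + 3 * b * ‖φ x‖ := by
    intro x
    rw [sigmaGrad_smul hζ' hφ1]
    refine (norm_add_le _ _).trans (add_le_add ?_ ?_)
    · rw [norm_smul]
      exact mul_le_of_le_one_left (norm_nonneg _) (hζ1 x)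
    · refine (norm_sum_le _ _).trans ?_
      have : ∀ j ∈ (Finset.univ : Finset (Fin 3)),
          ‖fderiv ℝ ζ x (EuclideanSpace.single j 1) • sigma j (φ x)‖ ≤ b * ‖φ x‖ := fun j _ => by
        rw [norm_smul, norm_sigma]
        refine mul_le_mul_of_nonneg_right ?_ (norm_nonneg _)
        refine ((fderiv ℝ ζ x).le_opNorm _).trans ?_
        simpa using hb x
      refine (Finset.sum_le_card_nsmul _ _ _ this).trans (le_of_eq ?_)
      simp
      ring
  have i2 : ∫ x, ‖x‖ / (1 + 1 * ‖x‖) * ‖sigmaGrad (fun x => ζ x • φ x) x‖ ^ 2 ≤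
      ∫ x, (2 * (coulombWeight x * ‖sigmaGrad φ x‖ ^ 2) + 2 * (3 * b) ^ 2 * ‖φ x‖ ^ 2) := by
    refine integral_mono_of_nonneg (Eventually.of_forall fun x => by positivity)
      ((h2.const_mul 2).add (h1.const_mul _)) (Eventually.of_forall fun x => ?_)
    have hw0 := coulombWeight_pos x
    have hw1 := coulombWeight_le_one x
    have hm : ‖x‖ / (1 + 1 * ‖x‖) ≤ coulombWeight x := by
      -- At the origin 0⁻¹ = 0 makes `coulombWeight` equal to 1, so the inequality is strict there;
      -- elsewhere the two sides agree.
      rcases eq_or_ne x 0 with rfl | hx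
      · simp [coulombWeight]
      · have := norm_pos_iff.2 hx
        unfold coulombWeight
        rw [div_le_iff₀ (by positivity), inv_mul_eq_div, le_div_iff₀ (by positivity)]
        field_simp
        rw [add_comm]
    have hg2 : ‖sigmaGrad (fun x => ζ x • φ x) x‖ ^ 2 ≤
        2 * ‖sigmaGrad φ x‖ ^ 2 + 2 * (3 * b) ^ 2 * ‖φ x‖ ^ 2 := by
      refine (pow_le_pow_left₀ (norm_nonneg _) (hgrad x) 2).trans ?_
      nlinarith [sq_nonneg (‖sigmaGrad φ x‖ - 3 * b * ‖φ x‖)]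
    calc ‖x‖ / (1 + 1 * ‖x‖) * ‖sigmaGrad (fun x => ζ x • φ x) x‖ ^ 2
        ≤ coulombWeight x * (2 * ‖sigmaGrad φ x‖ ^ 2 + 2 * (3 * b) ^ 2 * ‖φ x‖ ^ 2) :=
          mul_le_mul hm hg2 (sq_nonneg _) hw0.le
      _ = 2 * (coulombWeight x * ‖sigmaGrad φ x‖ ^ 2) +
          coulombWeight x * (2 * (3 * b) ^ 2 * ‖φ x‖ ^ 2) := by ring
      _ ≤ _ := by
          refine add_le_add_right (mul_le_of_le_one_left (by positivity) hw1) _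
  rw [integral_add (h2.const_mul 2) (h1.const_mul _), integral_const_mul, integral_const_mul] at i2
  linarith

/-- A square integrable `χ` with `σ·∇χ ∈ L² + |x|^{-1/2} L²` belongs to the domain of
`|x|^{-1/2}`. -/
theorem IsWeakDirac.memLp_rpow_smul {χ H : Space → Spinor} (hχH : IsWeakDirac χ H)
    (hχ : MemLp χ 2) (hH : LocallyIntegrable H)
    (hHw : Integrable fun x => coulombWeight x * ‖H x‖ ^ 2) :
    MemLp (fun x : Space => ‖x‖ ^ (-(1 / 2) : ℝ) • χ x) 2 := by
  have hχl : LocallyIntegrable χ := hχ.locallyIntegrable one_le_two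
  have hχ2 : Integrable fun x => ‖χ x‖ ^ 2 :=
    (memLp_two_iff_integrable_sq_norm hχ.aestronglyMeasurable).1 hχ
  obtain ⟨C, hC, hCb⟩ := exists_bump_convolution_inv_norm_le
  -- The radii shrink with fixed ratio 2, so a single constant C serves all kernels.
  set f : ℕ → ContDiffBump (0 : Space) := fun n =>
    ⟨1 / ((n : ℝ) + 1), 2 * (1 / ((n : ℝ) + 1)), by positivity, by
      have : (0 : ℝ) < 1 / ((n : ℝ) + 1) := by positivity
      linarith⟩ with hf
  set k : ℕ → Space → ℝ := fun n => (f n).normed volume with hk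
  have hkd : ∀ n, ContDiff ℝ ∞ (k n) := fun n => (f n).contDiff_normed
  have hkc : ∀ n, HasCompactSupport (k n) := fun n => (f n).hasCompactSupport_normed
  have hk0 : ∀ n x, 0 ≤ k n x := fun n x => (f n).nonneg_normed x
  have hki : ∀ n, Integrable (k n) := fun n => (f n).integrable_normed
  have hk1 : ∀ n, ∫ x, k n x = 1 := fun n => (f n).integral_normed
  have hunit : ∀ n, ∀ᵐ x : Space, ∫⁻ t, ENNReal.ofReal (k n (x - t) * ((1 : ℝ))⁻¹) ≤
      ENNReal.ofReal (1 * (1 : ℝ)⁻¹) := fun n => Eventually.of_forall fun x => by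
    simp only [inv_one, mul_one]
    rw [lintegral_ofReal_sub_left (hk0 n) (hki n) (hk1 n), ENNReal.ofReal_one]
  -- The inverse weight is 1 + |t|⁻¹: the first term is reproduced by convolution and the second
  -- grows by at most C, whence 1 + C.
  have hweight : ∀ n, ∀ᵐ x : Space, ∫⁻ t, ENNReal.ofReal (k n (x - t) * (coulombWeight t)⁻¹) ≤
      ENNReal.ofReal ((1 + C) * (coulombWeight x)⁻¹) := fun n => by
    filter_upwards [ae_ne_zero_space] with x hx
    have i1 : Integrable fun t => k n (x - t) := (hki n).comp_sub_left x
    have i2 : Integrable fun t => k n (x - t) * ‖t‖⁻¹ :=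
      locallyIntegrable_inv_norm.integrable_smul_left_of_hasCompactSupport
        (g := fun t => k n (x - t)) ((hkd n).continuous.comp (continuous_const.sub continuous_id))
        ((hkc n).comp_homeomorph (Homeomorph.subLeft x))
    have i3 : Integrable fun t => k n (x - t) + k n (x - t) * ‖t‖⁻¹ := i1.add i2
    simp only [coulombWeight, inv_inv, mul_add, mul_one]
    rw [← ofReal_integral_eq_lintegral_ofReal i3
      (Eventually.of_forall fun t => by have := hk0 n (x - t); simp only [Pi.zero_apply]; positivity),
      integral_add i1 i2, integral_sub_left_eq_self (k n) volume x, hk1]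
    refine ENNReal.ofReal_le_ofReal ?_
    have h1 := hCb (f n) le_rfl x hx
    have h2 : 0 ≤ ‖x‖⁻¹ := by positivity
    nlinarith
  have hcont : ∀ n (h : Space → Spinor), LocallyIntegrable h → ContDiff ℝ ∞ (mollify (k n) h) :=
    fun n h hh => contDiff_mollify (hkd n) (hkc n) hh
  have hbχ := fun n => integral_mollify_le (w := fun _ => 1) zero_le_one (hkd n).continuous (hk0 n)
    (hki n) (hk1 n) measurable_const (fun _ => one_pos) hχ.aestronglyMeasurable
    (by simpa using hχ2) (hcont n χ hχl).continuous (hunit n)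
  simp only [one_mul] at hbχ
  have hbH := fun n => integral_mollify_le (w := coulombWeight) (C := 1 + C) (by positivity)
    (hkd n).continuous (hk0 n) (hki n) (hk1 n) measurable_coulombWeight coulombWeight_pos
    hH.aestronglyMeasurable hHw (hcont n H hH).continuous (hweight n)
  have hgrad : ∀ n x, ‖sigmaGrad (mollify (k n) χ) x‖ = ‖mollify (k n) H x‖ := fun n x => by
    rw [← hχH.sigmaGrad_mollify hχl hH (hkd n) (hkc n) x, norm_smul]
    simp
  let ζ : ContDiffBump (0 : Space) := ⟨1, 2, one_pos, one_lt_two⟩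
  have hζ0 : ∀ x, |ζ x| ≤ 1 := fun x => by
    rw [abs_of_nonneg ζ.nonneg]
    exact ζ.le_one
  obtain ⟨B, hB, hcut⟩ := exists_hardy_cutoff (ζ := ζ) ζ.contDiff ζ.hasCompactSupport hζ0
  have hbound : ∀ n, ∫ x, ‖‖x‖ ^ (-(1 / 2) : ℝ) • ζ x • mollify (k n) χ x‖ ^ 2 ≤
      B * (∫ x, ‖χ x‖ ^ 2) + 2 * ((1 + C) * ∫ x, coulombWeight x * ‖H x‖ ^ 2) := fun n => by
    simp only [norm_sq_rpow_smul]
    have h := hcut (mollify (k n) χ) (hcont n χ hχl) (hbχ n).1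
      (by simpa only [hgrad] using (hbH n).1)
    simp only [hgrad] at h
    refine h.trans (add_le_add (mul_le_mul_of_nonneg_left (hbχ n).2 hB) ?_)
    exact mul_le_mul_of_nonneg_left (hbH n).2 zero_le_two
  have hlim : ∀ᵐ x, Tendsto (fun n => mollify (k n) χ x) atTop (𝓝 (χ x)) := by
    simp only [mollify_eq_convolution]
    refine ContDiffBump.ae_convolution_tendsto_right_of_locallyIntegrable (K := 2) ?_ ?_ hχl
    · have h := tendsto_one_div_add_atTop_nhds_zero_nat.const_mul (2 : ℝ)
      rwa [mul_zero] at h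
    · exact Eventually.of_forall fun n => le_rfl
  have hζχ : MemLp (fun x : Space => ‖x‖ ^ (-(1 / 2) : ℝ) • ζ x • χ x) 2 := by
    refine memLp_two_of_ae_tendsto
      (f := fun n x => ‖x‖ ^ (-(1 / 2) : ℝ) • ζ x • mollify (k n) χ x) (fun n => ?_) ?_ hbound
    · have ht : IsTestSpinor fun x => ζ x • mollify (k n) χ x :=
        ⟨ζ.contDiff.smul (hcont n χ hχl), ζ.hasCompactSupport.smul_right⟩
      exact ht.memLp_rpow_smul
    · filter_upwards [hlim] with x hx
      exact (hx.const_smul _).const_smul _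
  refine MemLp.of_le (hζχ.norm.add hχ.norm)
    (measurable_rpow_norm.aestronglyMeasurable.smul hχ.aestronglyMeasurable)
    (Eventually.of_forall fun x => ?_)
  simp only [Pi.add_apply]
  rw [Real.norm_of_nonneg (by positivity)]
  -- The cutoff is 1 on the unit ball; outside it |x|^{-1/2} ≤ 1 and χ ∈ L² suffices.
  by_cases hx : ‖x‖ ≤ 1
  · have : ζ x = 1 := ζ.one_of_mem_closedBall (by simpa using hx)
    rw [this, one_smul]
    exact le_add_of_nonneg_right (norm_nonneg _)
  · refine le_add_of_nonneg_of_le (norm_nonneg _) ?_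
    rw [norm_smul, Real.norm_of_nonneg (by positivity)]
    refine mul_le_of_le_one_left (norm_nonneg _) ?_
    exact Real.rpow_le_one_of_one_le_of_nonpos (not_le.1 hx).le (by norm_num)

/-- The potential term can be moved to the right: with w = `coulombWeight`, w|x|⁻² ≤ |x|⁻¹, so Vφ is
square integrable against w as soon as |x|^{-1/2}φ ∈ L². -/
theorem WeakMemL2.memLp_rpow_smul {V : Space → ℝ} (hV : AEMeasurable V) {ν b : ℝ}
    (hVν : ∀ x : Space, x ≠ 0 → ‖x‖ * |V x| ≤ ν) {φ χ : L2Spinor}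
    (hφ : MemLp (fun x : Space => ‖x‖ ^ (-(1 / 2) : ℝ) • φ x) 2)
    (hφχ : WeakMemL2 (fun x => b + V x) φ χ) :
    MemLp (fun x : Space => ‖x‖ ^ (-(1 / 2) : ℝ) • χ x) 2 := by
  obtain ⟨F, hF⟩ := hφχ
  set G : Space → Spinor := fun x => ((b + V x : ℝ) : ℂ) • φ x with hG
  have hGm : AEStronglyMeasurable G :=
    (Complex.measurable_ofReal.comp_aemeasurable (hV.const_add b)).aestronglyMeasurable.smul
      (Lp.aestronglyMeasurable φ)
  have hmeas : AEStronglyMeasurable (fun x => F x - G x) :=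
    (Lp.aestronglyMeasurable F).sub hGm
  have hsq : ∀ ψ : L2Spinor, Integrable fun x => ‖ψ x‖ ^ 2 := fun ψ =>
    (memLp_two_iff_integrable_sq_norm (Lp.aestronglyMeasurable ψ)).1 (Lp.memLp ψ)
  have hφ2 : Integrable fun x => ‖x‖⁻¹ * ‖φ x‖ ^ 2 := by
    have := (memLp_two_iff_integrable_sq_norm hφ.aestronglyMeasurable).1 hφ
    simpa only [norm_sq_rpow_smul] using this
  have hHw : Integrable fun x => coulombWeight x * ‖F x - G x‖ ^ 2 := by
    refine Integrable.mono' (((hsq F).add (((hsq φ).const_mul (b ^ 2)).add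
      (hφ2.const_mul (ν ^ 2)))).const_mul 3)
      (measurable_coulombWeight.aestronglyMeasurable.mul (hmeas.norm.pow 2)) ?_
    filter_upwards [ae_ne_zero_space] with x hx
    have hx' := norm_pos_iff.2 hx
    have hw0 := coulombWeight_pos x
    have hw1 := coulombWeight_le_one x
    rw [Real.norm_of_nonneg (by positivity)]
    simp only [Pi.add_apply]
    have hVx : |V x| ≤ ν * ‖x‖⁻¹ := by
      rw [← div_eq_mul_inv, le_div_iff₀ hx', mul_comm]
      exact hVν x hx
    have h1 : ‖F x - G x‖ ≤ ‖F x‖ + |b| * ‖φ x‖ + ν * ‖x‖⁻¹ * ‖φ x‖ := by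
      refine (norm_sub_le _ _).trans ?_
      rw [add_assoc, ← add_mul]
      refine add_le_add_right ?_ _
      simp only [hG]
      rw [norm_smul, Complex.norm_real, Real.norm_eq_abs]
      refine mul_le_mul_of_nonneg_right ((abs_add_le _ _).trans ?_) (norm_nonneg _)
      linarith
    have h2 : ‖F x - G x‖ ^ 2 ≤
        3 * (‖F x‖ ^ 2 + b ^ 2 * ‖φ x‖ ^ 2 + ν ^ 2 * (‖x‖⁻¹ ^ 2 * ‖φ x‖ ^ 2)) := by
      refine (pow_le_pow_left₀ (norm_nonneg _) h1 2).trans ?_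
      rw [← sq_abs b]
      nlinarith [sq_nonneg (‖F x‖ - |b| * ‖φ x‖), sq_nonneg (‖F x‖ - ν * ‖x‖⁻¹ * ‖φ x‖),
        sq_nonneg (|b| * ‖φ x‖ - ν * ‖x‖⁻¹ * ‖φ x‖)]
    have h3 : coulombWeight x * ‖x‖⁻¹ ^ 2 ≤ ‖x‖⁻¹ := by
      unfold coulombWeight
      rw [inv_mul_le_iff₀ (by positivity)]
      have : 0 < ‖x‖⁻¹ := by positivity
      nlinarith
    calc coulombWeight x * ‖F x - G x‖ ^ 2
        ≤ coulombWeight x *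
          (3 * (‖F x‖ ^ 2 + b ^ 2 * ‖φ x‖ ^ 2 + ν ^ 2 * (‖x‖⁻¹ ^ 2 * ‖φ x‖ ^ 2))) :=
          mul_le_mul_of_nonneg_left h2 hw0.le
      _ = 3 * (coulombWeight x * (‖F x‖ ^ 2 + b ^ 2 * ‖φ x‖ ^ 2) +
          ν ^ 2 * ((coulombWeight x * ‖x‖⁻¹ ^ 2) * ‖φ x‖ ^ 2)) := by ring
      _ ≤ 3 * ((‖F x‖ ^ 2 + b ^ 2 * ‖φ x‖ ^ 2) + ν ^ 2 * (‖x‖⁻¹ * ‖φ x‖ ^ 2)) := by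
          refine mul_le_mul_of_nonneg_left (add_le_add ?_ ?_) (by norm_num)
          · exact mul_le_of_le_one_left (by positivity) hw1
          · exact mul_le_mul_of_nonneg_left
              (mul_le_mul_of_nonneg_right h3 (sq_nonneg _)) (sq_nonneg _)
      _ = _ := by ring
  -- Since s ≤ w⁻¹ + w s² for s ≥ 0, and w⁻¹ = 1 + |x|⁻¹ is locally integrable, weighted square
  -- integrability implies local integrability.
  have hHl : LocallyIntegrable fun x => F x - G x := by
    have hdom : LocallyIntegrable fun x : Space =>
        1 + ‖x‖⁻¹ + coulombWeight x * ‖F x - G x‖ ^ 2 :=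
      ((locallyIntegrable_const 1).add locallyIntegrable_inv_norm).add hHw.locallyIntegrable
    refine hdom.mono hmeas (Eventually.of_forall fun x => ?_)
    have hw0 := coulombWeight_pos x
    have hw : 1 + ‖x‖⁻¹ = (coulombWeight x)⁻¹ := (inv_inv _).symm
    rw [hw]
    refine le_trans ?_ (le_abs_self _)
    have h1 : ‖F x - G x‖ * 1 ≤ (coulombWeight x)⁻¹ + coulombWeight x * ‖F x - G x‖ ^ 2 := by
      have h2 : coulombWeight x * (coulombWeight x)⁻¹ = 1 := mul_inv_cancel₀ hw0.ne'
      have h3 : 0 < (coulombWeight x)⁻¹ := by positivity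
      have h4 : 0 ≤ coulombWeight x * (‖F x - G x‖ - (coulombWeight x)⁻¹) ^ 2 := by positivity
      have h5 : coulombWeight x * (‖F x - G x‖ - (coulombWeight x)⁻¹) ^ 2 =
          coulombWeight x * ‖F x - G x‖ ^ 2 - 2 * ‖F x - G x‖ + (coulombWeight x)⁻¹ := by
        field_simp
        ring
      have := norm_nonneg (F x - G x)
      linarith
    linarith
  have hFl : LocallyIntegrable F := (Lp.memLp F).locallyIntegrable one_le_two
  have hGl : LocallyIntegrable G := by
    have := hFl.sub hHl
    have e : (⇑F - fun x => F x - G x) = G := by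
      ext1 x
      simp
    rwa [e] at this
  have hweak : IsWeakDirac χ fun x => F x - G x := fun η hη => by
    have h := hF η hη
    have hηc := hη.1.continuous
    simp only [inner_sub_right]
    rw [integral_sub (integrable_inner_of_locallyIntegrable hηc hη.2 hFl)
      (integrable_inner_of_locallyIntegrable hηc hη.2 hGl), ← h]
    exact (add_sub_cancel_left _ _).symm
  exact hweak.memLp_rpow_smul (Lp.memLp χ) hHl hHw

end DiracHardy

/-! ### Conclusion -/

theorem proposition4 (V : DiracHardy.Space → ℝ) (hV_meas : AEMeasurable V volume)
    (hV_nonpos : ∀ x, V x ≤ 0)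
    (hV_sup : ∃ ν : ℝ, ν < 1 ∧ ∀ x : DiracHardy.Space, x ≠ 0 → ‖x‖ * |V x| ≤ ν) :
    (∃ c : ℝ, DiracHardy.HardyDiracAssumption V c) ∧
    ∀ c : ℝ, DiracHardy.HardyDiracAssumption V c →
      ∀ γ : ℝ, (⨆ x, V x) < γ → γ < 1 + c →
        DiracHardy.diracDomain V γ ⊆ DiracHardy.invSqrtDomain := by
  obtain ⟨ν₀, hν₀, hVν₀⟩ := hV_sup
  obtain ⟨ν, hν, hν1, hVν⟩ : ∃ ν : ℝ, 0 < ν ∧ ν < 1 ∧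
      ∀ x : DiracHardy.Space, x ≠ 0 → ‖x‖ * |V x| ≤ ν :=
    -- The Coulomb constant is enlarged to be strictly positive, because the estimates divide by it.
    ⟨max ν₀ (1 / 2), by positivity, max_lt hν₀ (by norm_num),
      fun x hx => (hVν₀ x hx).trans (le_max_left _ _)⟩
  refine ⟨⟨ν ^ 2 - 1, DiracHardy.hardyDiracAssumption_of_coulomb_bound hV_meas hV_nonpos hν hν1 hVν⟩, ?_⟩
  rintro c - γ hγ - ⟨φ, χ⟩ ⟨hφ, hφχ, -⟩
  have hbdd : BddAbove (Set.range V) := ⟨0, by rintro _ ⟨x, rfl⟩; exact hV_nonpos x⟩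
  have hφr := DiracHardy.memLp_rpow_smul_of_mem_formDomain hV_meas hν hν1 hVν (sub_pos.2 hγ)
    (fun x => sub_le_sub_left (le_ciSup hbdd x) γ) hφ
  exact ⟨hφr, DiracHardy.WeakMemL2.memLp_rpow_smul hV_meas hVν hφr hφχ⟩
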